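/- **Theorem 3.2.** Let $\mathbb{T}=\mathbb{R}/2\pi\mathbb{Z}$, $J=\begin{bmatrix}0&-1\\1&0\end{bmatrix}$, and let $\tilde\beta(t,x)=[\tilde\beta_{jk}(t,x)]_{j,k=1,2}$ and $\tilde\gamma(t,x)=[\tilde\gamma_{jk}(t,x)]_{j,k=1,2}$ be real $2\times2$ matrices whose entries all belong to $C_b^1(\mathbb{R};C^\infty(\mathbb{T};\mathbb{R}))$, the set of all $a\in C^1(\mathbb{R};C^\infty(\mathbb{T};\mathbb{R}))$ such that $a$ and $a_t$ are bounded continuous functions of $t\in\mathbb{R}$ with values in the Fréchet space $C^\infty(\mathbb{T};\mathbb{R})$. Consider the initial value problem $$\vec w_t+J\,\vec w_{xxxx}+\tilde\beta(t,x)\,\vec w_{xx}+\tilde\gamma(t,x)\,\vec w_x=\vec h(t,x)\ \text{ in }\mathbb{R}\times\mathbb{T},\qquad \vec w(0,x)=\vec w_0(x)\ \text{ in }\mathbb{T},$$ for an $\mathbb{R}^2$-valued unknown $\vec w(t,x)$. If, for every $t\in\mathbb{R}$, $$\int_0^{2\pi}\operatorname{tr}\bigl(\tilde\beta(t,x)\bigr)\,dx=0\qquad\text{and}\qquad\int_0^{2\pi}\operatorname{tr}\bigl(J\tilde\gamma(t,x)\bigr)\,dx=0,$$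 then the initial value problem is $L^2$-well-posed, that is, for every $\vec w_0\in L^2(\mathbb{T};\mathbb{R}^2)$ and every $\vec h\in L^1_{\mathrm{loc}}(\mathbb{R};L^2(\mathbb{T};\mathbb{R}^2))$ it has a unique solution $\vec w\in C(\mathbb{R};L^2(\mathbb{T};\mathbb{R}^2))$. Here $\vec w\in C(\mathbb{R};L^2(\mathbb{T};\mathbb{R}^2))$ is called a solution if $\vec w(0)=\vec w_0$ and the equation holds weakly: for every $\vec\varphi\in C^\infty(\mathbb{T};\mathbb{R}^2)$ and every $t\in\mathbb{R}$, $$\langle\vec w(t),\vec\varphi\rangle-\langle\vec w(0),\vec\varphi\rangle=\int_0^t\Bigl\{\langle\vec h(s),\vec\varphi\rangle-\bigl\langle\vec w(s),\,\partial_x^4({}^tJ\vec\varphi)+\partial_x^2({}^t\tilde\beta(s)\vec\varphi)-\partial_x({}^t\tilde\gamma(s)\vec\varphi)\bigr\rangle\Bigr\}\,ds,$$ where $\langle\cdot,\cdot\rangle$ is the inner product of $L^2(\mathbb{T};\mathbb{R}^2)$. -/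

import Mathlib

open MeasureTheory Filter Topology
open scoped ContDiff

namespace DispersiveTorus

instance factTwoPiPos : Fact (0 < 2 * Real.pi) := ⟨Real.two_pi_pos⟩

/-- The torus `ℝ / 2πℤ`, with its Lebesgue measure of total mass `2π`. -/
abbrev Torus : Type := AddCircle (2 * Real.pi)

/-- `ℝ²` with the Euclidean inner product. -/
abbrev Vec : Type := EuclideanSpace ℝ (Fin 2)

/-- Real `2 × 2` matrices. -/
abbrev Mat : Type := Matrix (Fin 2) (Fin 2) ℝ

/-- The real Hilbert space `L²(𝕋; ℝ²)`. -/
abbrev L2 : Type := Lp Vec 2 (volume : Measure Torus)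

/-- `f : 𝕋 → F` is smooth: its `2π`-periodic lift to `ℝ` is `C^∞`. -/
def IsSmooth {F : Type*} [NormedAddCommGroup F] [NormedSpace ℝ F] (f : Torus → F) : Prop :=
  ContDiff ℝ ∞ (fun y : ℝ => f (y : Torus))

/-- The `k`-th derivative `∂ₓᵏ f` of a function on the torus. -/
noncomputable def dx {F : Type*} [NormedAddCommGroup F] [NormedSpace ℝ F]
    (k : ℕ) (f : Torus → F) (x : Torus) : F :=
  iteratedDeriv k (fun y : ℝ => f (x + (y : Torus))) 0

/-- `a ∈ C_b(ℝ; C^∞(𝕋; ℝ))`: every `a t` is smooth, and `t ↦ a t` is bounded and continuous for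
the Fréchet topology of `C^∞(𝕋; ℝ)`, given by the seminorms `f ↦ sup |∂ₓᵏ f|`. -/
structure MemCb (a : ℝ → Torus → ℝ) : Prop where
  smooth : ∀ t, IsSmooth (a t)
  bounded : ∀ k : ℕ, ∃ C : ℝ, ∀ t x, |dx k (a t) x| ≤ C
  continuous : ∀ (k : ℕ) (t₀ : ℝ),
    TendstoUniformly (fun t x => dx k (a t) x) (dx k (a t₀)) (𝓝 t₀)

/-- `a' t₀` is, for every `t₀`, the derivative at `t₀` of the curve `t ↦ a t` in the Fréchet space
`C^∞(𝕋; ℝ)`: the difference quotients converge to it in every seminorm `f ↦ sup |∂ₓᵏ f|`. -/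
def HasTimeDeriv (a a' : ℝ → Torus → ℝ) : Prop :=
  ∀ (k : ℕ) (t₀ : ℝ),
    TendstoUniformly (fun t x => (dx k (a t) x - dx k (a t₀) x) / (t - t₀))
      (dx k (a' t₀)) (𝓝[≠] t₀)

/-- `a ∈ C_b¹(ℝ; C^∞(𝕋; ℝ))`: both `a` and its time derivative `a_t` exist and lie in
`C_b(ℝ; C^∞(𝕋; ℝ))`. -/
def MemCb1 (a : ℝ → Torus → ℝ) : Prop :=
  MemCb a ∧ ∃ a' : ℝ → Torus → ℝ, MemCb a' ∧ HasTimeDeriv a a'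

/-- The matrix `J = [0, -1; 1, 0]`. -/
def J : Mat := !![0, -1; 1, 0]

/-- The matrix-vector product `M v` in `ℝ²`. -/
noncomputable def mulVec (M : Mat) (v : Vec) : Vec := WithLp.toLp 2 (M.mulVec v.ofLp)

/-- The formal adjoint, at time `t`, of the spatial operator
`J ∂ₓ⁴ + β(t, x) ∂ₓ² + γ(t, x) ∂ₓ`, applied to a function `φ : 𝕋 → ℝ²`:
`∂ₓ⁴ (Jᵀ φ) + ∂ₓ² (βᵀ φ) - ∂ₓ (γᵀ φ)`. -/
noncomputable def adjointOp (β γ : ℝ → Torus → Mat) (t : ℝ) (φ : Torus → Vec) (x : Torus) : Vec :=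
  dx 4 (fun y => mulVec J.transpose (φ y)) x
    + dx 2 (fun y => mulVec (β t y).transpose (φ y)) x
    - dx 1 (fun y => mulVec (γ t y).transpose (φ y)) x

/-- `w ∈ C(ℝ; L²(𝕋; ℝ²))` is a (weak) solution of
`w_t + J w_xxxx + β w_xx + γ w_x = h` in `ℝ × 𝕋` with `w(0) = w₀`: tested against any
`φ ∈ C^∞(𝕋; ℝ²)`, the equation, integrated in time, holds after all the derivatives in `x` have
been moved to `φ`. -/
structure IsSolution (β γ : ℝ → Torus → Mat) (h : ℝ → L2) (w₀ : L2) (w : C(ℝ, L2)) : Prop where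
  initial : w 0 = w₀
  weak : ∀ φ : Torus → Vec, IsSmooth φ → ∀ t : ℝ,
    (∫ x, inner ℝ (w t x) (φ x)) - ∫ x, inner ℝ (w 0 x) (φ x)
      = ∫ s in (0 : ℝ)..t,
          ((∫ x, inner ℝ (h s x) (φ x)) - ∫ x, inner ℝ (w s x) (adjointOp β γ s φ x))

/-- The initial value problem for `∂ₜ + J ∂ₓ⁴ + β ∂ₓ² + γ ∂ₓ` is `L²`-well-posed: for all
`w₀ ∈ L²(𝕋; ℝ²)` and `h ∈ L¹_loc(ℝ; L²(𝕋; ℝ²))` there is a unique solution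
`w ∈ C(ℝ; L²(𝕋; ℝ²))`. -/
def L2WellPosed (β γ : ℝ → Torus → Mat) : Prop :=
  ∀ (w₀ : L2) (h : ℝ → L2), LocallyIntegrable h volume →
    ∃! w : C(ℝ, L2), IsSolution β γ h w₀ w

end DispersiveTorus

/-! Identify `ℝ²` with `ℂ`. Then `J` is multiplication by `i`, a real matrix acts as `z ↦ p z + q
z̄`, and with `C` the complex conjugation the equation reads `w_t = L w + h`, where `L = -i∂⁴ - (p_β
+ q_β C)∂² - (p_γ + q_γ C)∂`. A direct energy estimate loses derivatives in the terms of orders two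
and one. They are removed by a bounded change of unknown `T = 1 + S` with `L T = T Λ + R`, where `Λ`
is diagonal on Fourier modes and `R` is bounded.

Here `S = a₁σ + a₂σ² + c₂Cσ² + c₃Cσ³`, where `σ` is `∂⁻¹` cut off to frequencies `|k| ≥ N`. The
conjugate-linear terms can always be removed: `C` anticommutes with `i`, so its commutator with
`-i∂⁴` has full order four, and `c₂`, `c₃` are found algebraically. The complex-linear terms lead to
transport equations `4i a' = g`, solvable on the circle only when `g` has mean zero, so the means
`n₂`, `n₁` of the coefficients stay in the symbol `-iκ⁴ + n₂κ² + n₁κ`, `κ = ik`, of `Λ`. The trace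
conditions say that `Re n₂ = 0` and `Im n₁ = 0`; the symbol is then imaginary and `Λ` generates an
isometric evolution. See `exists_symbols`, `diffOp_conjugation` and `exists_conjugator`. For large
`N` one has `‖S‖ ≤ 1/2`, so `T` is invertible.

For existence (`Conjugator.exists_weak_solution`), put `w = T v`: the equation for `v` is `Λ` plus a
bounded perturbation, and undoing the evolution of `Λ` leaves a Volterra equation. For uniqueness
(`Conjugator.eq_zero_of_weak`), the formal adjoint also has principal part `-i∂⁴` and satisfies the
same conditions on means, so it has a conjugator too. Testing a difference of two solutions against
`T` applied to the modes gives an equation for `T* w` to which Gronwall's inequality applies. -/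

namespace DispersiveTorus

open scoped ComplexConjugate

/-! ### Linear evolution equations in Banach spaces -/

section EvolutionEquations

variable {E F : Type*} [NormedAddCommGroup E] [NormedSpace ℝ E] [CompleteSpace E]
  [NormedAddCommGroup F] [NormedSpace ℝ F] [CompleteSpace F]

/-- Product rule for a `C¹` family of operators applied to a primitive of a locally integrable
function. -/
theorem clm_apply_primitive {Q Q' : ℝ → E →L[ℝ] F} (hQ : ∀ t, HasDerivAt Q (Q' t) t)
    (hQ' : Continuous Q') {g : ℝ → E} (hg : LocallyIntegrable g volume) (f₀ : E) (t : ℝ) :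
    Q t (f₀ + ∫ s in (0 : ℝ)..t, g s) = Q 0 f₀
      + ∫ s in (0 : ℝ)..t, (Q' s (f₀ + ∫ r in (0 : ℝ)..s, g r) + Q s (g s)) := by
  have hgi : ∀ a b : ℝ, IntervalIntegrable g volume a b := fun a b =>
    (hg.integrableOn_isCompact isCompact_uIcc).intervalIntegrable
  have hQc : Continuous Q := continuous_iff_continuousAt.2 fun t => (hQ t).continuousAt
  set f : ℝ → E := fun t => f₀ + ∫ s in (0 : ℝ)..t, g s with hf
  have hfc : Continuous f :=
    continuous_const.add (intervalIntegral.continuous_primitive hgi 0)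
  have hQg : ∀ a b : ℝ, IntervalIntegrable (fun s => Q s (g s)) volume a b := by
    intro a b
    obtain ⟨M, hM⟩ := (isCompact_uIcc (a := a) (b := b)).exists_bound_of_continuousOn
      hQc.continuousOn
    refine ((hgi a b).norm.const_mul M).mono_fun ?_ ?_
    · have h1 : AEStronglyMeasurable g (volume.restrict (Set.uIoc a b)) :=
        (hgi a b).def'.aestronglyMeasurable
      exact (isBoundedBilinearMap_apply (𝕜 := ℝ) (E := E) (F := F)).continuous.comp_aestronglyMeasurable
        (hQc.aestronglyMeasurable.prodMk h1)
    · refine (ae_restrict_iff' measurableSet_uIoc).2 (Eventually.of_forall fun s hs => ?_)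
      calc ‖Q s (g s)‖ ≤ ‖Q s‖ * ‖g s‖ := (Q s).le_opNorm _
        _ ≤ M * ‖g s‖ := by
          gcongr; exact hM s (Set.uIoc_subset_uIcc hs)
        _ ≤ ‖M * ‖g s‖‖ := le_abs_self _
  have hQ'f : Continuous fun s => Q' s (f s) := hQ'.clm_apply hfc
  -- `f` is in general differentiable only almost everywhere, yet the difference of the two sides
  -- has derivative zero at every point: freezing `f s` leaves the remainder `∫ r in s..t, (Q t - Q
  -- r) (g r)`, which is `o(t - s)` because `Q` is locally Lipschitz and the integral of `‖g‖` from
  -- `s` to `t` tends to zero.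
  have key : ∀ s, HasDerivAt (fun t => Q t (f t) - ∫ r in (0 : ℝ)..t, (Q' r (f r) + Q r (g r))) 0 s := by
    intro s
    have hA : HasDerivAt (fun t => Q t (f s) - ∫ r in (0 : ℝ)..t, Q' r (f r))
        (Q' s (f s) - Q' s (f s)) s := by
      refine HasDerivAt.sub ?_ ?_
      · simpa using (hQ s).clm_apply (hasDerivAt_const s (f s))
      · exact intervalIntegral.integral_hasDerivAt_right (hQ'f.intervalIntegrable _ _)
          hQ'f.stronglyMeasurable.stronglyMeasurableAtFilter hQ'f.continuousAt
    have hB : HasDerivAt (fun t => ∫ r in s..t, (Q t (g r) - Q r (g r))) 0 s := by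
      obtain ⟨M, hM⟩ := (isCompact_Icc (a := s - 1) (b := s + 1)).exists_bound_of_continuousOn
        hQ'.continuousOn
      have hlip : ∀ x ∈ Set.Icc (s - 1) (s + 1), ∀ y ∈ Set.Icc (s - 1) (s + 1),
          ‖Q y - Q x‖ ≤ M * ‖y - x‖ := fun x hx y hy =>
        (convex_Icc _ _).norm_image_sub_le_of_norm_hasDerivWithin_le
          (fun z hz => (hQ z).hasDerivWithinAt) hM hx hy
      have hM0 : 0 ≤ M := (norm_nonneg _).trans (hM s ⟨by linarith, by linarith⟩)
      have hG : Tendsto (fun t => M * |∫ r in s..t, ‖g r‖|) (𝓝 s) (𝓝 0) := by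
        have : Continuous fun t => M * |∫ r in s..t, ‖g r‖| :=
          continuous_const.mul (intervalIntegral.continuous_primitive (fun a b => (hgi a b).norm) s).abs
        simpa using this.tendsto s
      rw [hasDerivAt_iff_isLittleO, Asymptotics.isLittleO_iff]
      intro c hc
      have h1 : ∀ᶠ t in 𝓝 s, M * |∫ r in s..t, ‖g r‖| ≤ c := (hG.eventually_lt_const hc).mono fun _ h => h.le
      have h2 : ∀ᶠ t in 𝓝 s, t ∈ Set.Icc (s - 1) (s + 1) := Icc_mem_nhds (by linarith) (by linarith)
      filter_upwards [h1, h2] with t ht1 ht2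
      simp only [intervalIntegral.integral_same, sub_zero, smul_zero]
      have : ‖∫ r in s..t, (Q t (g r) - Q r (g r))‖ ≤ |∫ r in s..t, (M * |t - s|) * ‖g r‖| := by
        refine intervalIntegral.norm_integral_le_abs_of_norm_le ?_ (((hgi s t).norm).const_mul _)
        refine (ae_restrict_iff' measurableSet_uIoc).2 (Eventually.of_forall fun r hr => ?_)
        have hr' := Set.uIoc_subset_uIcc hr
        have hrI : r ∈ Set.Icc (s - 1) (s + 1) :=
          Set.uIcc_subset_Icc ⟨by linarith, by linarith⟩ ht2 hr'
        have : |t - r| ≤ |t - s| := by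
          have := Set.abs_sub_left_of_mem_uIcc (Set.uIcc_comm s t ▸ hr')
          rw [abs_sub_comm t r, abs_sub_comm t s]; exact this
        calc ‖Q t (g r) - Q r (g r)‖ = ‖(Q t - Q r) (g r)‖ := rfl
          _ ≤ ‖Q t - Q r‖ * ‖g r‖ := (Q t - Q r).le_opNorm _
          _ ≤ (M * |t - s|) * ‖g r‖ := by
            gcongr
            exact (hlip r hrI t ht2).trans (by rw [Real.norm_eq_abs]; gcongr)
      refine this.trans ?_
      rw [intervalIntegral.integral_const_mul, abs_mul, abs_of_nonneg (by positivity : 0 ≤ M * |t - s|),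
        Real.norm_eq_abs]
      calc M * |t - s| * |∫ r in s..t, ‖g r‖| = (M * |∫ r in s..t, ‖g r‖|) * |t - s| := by ring
        _ ≤ c * |t - s| := by gcongr
    have hAB := (hA.add hB).sub_const (∫ r in (0 : ℝ)..s, Q r (g r))
    simp only [sub_self, add_zero] at hAB
    refine hAB.congr_of_eventuallyEq (Eventually.of_forall fun t => ?_)
    have e1 : ∫ r in s..t, (Q t (g r) - Q r (g r)) = Q t (∫ r in s..t, g r) - ∫ r in s..t, Q r (g r) := by
      rw [intervalIntegral.integral_sub (f := fun r => Q t (g r))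
        ⟨(Q t).integrable_comp (hgi s t).1, (Q t).integrable_comp (hgi s t).2⟩ (hQg s t),
        (Q t).intervalIntegral_comp_comm (hgi s t)]
    have e2 : f t = f s + ∫ r in s..t, g r := by
      simp only [hf, add_assoc]
      rw [intervalIntegral.integral_add_adjacent_intervals (hgi _ _) (hgi _ _)]
    have e3 : ∫ r in (0 : ℝ)..t, (Q' r (f r) + Q r (g r)) =
        (∫ r in (0 : ℝ)..t, Q' r (f r)) + ∫ r in (0 : ℝ)..t, Q r (g r) :=
      intervalIntegral.integral_add (hQ'f.intervalIntegrable _ _) (hQg _ _)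
    have e4 := intervalIntegral.integral_add_adjacent_intervals (hQg 0 s) (hQg s t)
    simp only [Pi.add_apply, e1, e3, ← e4]
    rw [e2, map_add]
    abel
  have hc := is_const_of_deriv_eq_zero (fun s => (key s).differentiableAt) (fun s => (key s).deriv) t 0
  simp only [intervalIntegral.integral_same, sub_zero] at hc
  have h0 : f 0 = f₀ := by simp [hf]
  rw [h0] at hc
  exact sub_eq_iff_eq_add.1 hc

omit [CompleteSpace E] in
/-- A solution of a linear differential inequality that vanishes at time `0` vanishes. -/
theorem eq_zero_of_norm_deriv_le {y b : ℝ → E} {m : ℝ → ℝ} (hy : ∀ t, HasDerivAt y (b t) t)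
    (hm : Continuous m) (hb : ∀ t, ‖b t‖ ≤ m t * ‖y t‖) (h0 : y 0 = 0) (t : ℝ) : y t = 0 := by
  have forward : ∀ {y b : ℝ → E} {m : ℝ → ℝ}, (∀ t, HasDerivAt y (b t) t) → Continuous m →
      (∀ t, ‖b t‖ ≤ m t * ‖y t‖) → y 0 = 0 → ∀ t, 0 ≤ t → y t = 0 := by
    intro y b m hy hm hb h0 t ht
    obtain ⟨M, hM⟩ := (isCompact_Icc (a := 0) (b := t)).exists_bound_of_continuousOn hm.continuousOn
    have hyc : Continuous y := continuous_iff_continuousAt.2 fun t => (hy t).continuousAt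
    have := norm_le_gronwallBound_of_norm_deriv_right_le (f := y) (f' := b) (δ := 0) (K := M) (ε := 0)
      (a := 0) (b := t) hyc.continuousOn (fun x _ => (hy x).hasDerivWithinAt) (by simp [h0])
      (fun x hx => by
        rw [add_zero]
        refine (hb x).trans ?_
        gcongr
        exact (le_abs_self _).trans (hM x ⟨hx.1, hx.2.le⟩)) t ⟨ht, le_rfl⟩
    simpa [gronwallBound_ε0_δ0] using this
  rcases le_total 0 t with ht | ht
  · exact forward hy hm hb h0 t ht
  · have := forward (y := fun t => y (-t)) (b := fun t => -b (-t)) (m := fun t => m (-t))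
      (fun t => by simpa [Function.comp_def] using (hy (-t)).scomp t (hasDerivAt_neg t)) (hm.comp continuous_neg)
      (fun t => by simpa using hb (-t)) (by simpa using h0) (-t) (by linarith)
    simpa using this

/-- Linear Volterra equations of the second kind are solvable globally in time. -/
theorem exists_volterra_solution {C : ℝ → E →L[ℝ] E}
    (hC : ∀ y : ℝ → E, Continuous y → Continuous fun t => C t (y t))
    {m : ℝ → ℝ} (hm : Continuous m) (hCm : ∀ t, ‖C t‖ ≤ m t) {f : ℝ → E} (hf : Continuous f) :
    ∃ y : ℝ → E, Continuous y ∧ ∀ t, y t = f t + ∫ s in (0 : ℝ)..t, C s (y s) := by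
  -- `Y n` is the `n`-th term of the Neumann series, not a partial sum; iterated integration gains
  -- the factorial that makes the series converge on every bounded interval.
  let Y : ℕ → C(ℝ, E) := fun n => Nat.rec ⟨f, hf⟩ (fun _ z => ⟨fun t => ∫ s in (0 : ℝ)..t, C s (z s),
    intervalIntegral.continuous_primitive (fun a b => (hC z z.continuous).intervalIntegrable a b) 0⟩) n
  have hY0 : ∀ t, Y 0 t = f t := fun t => rfl
  have hYs : ∀ n t, Y (n + 1) t = ∫ s in (0 : ℝ)..t, C s (Y n s) := fun n t => rfl
  have hbd : ∀ T : ℝ, 0 ≤ T → ∃ B M : ℝ, 0 ≤ B ∧ 0 ≤ M ∧ ∀ n, ∀ t ∈ Set.Icc (-T) T,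
      ‖Y n t‖ ≤ B * (M * T) ^ n / n.factorial := by
    intro T hT
    obtain ⟨B, hB⟩ := (isCompact_Icc (a := -T) (b := T)).exists_bound_of_continuousOn hf.continuousOn
    obtain ⟨M, hM⟩ := (isCompact_Icc (a := -T) (b := T)).exists_bound_of_continuousOn hm.continuousOn
    have h0 : (0 : ℝ) ∈ Set.Icc (-T) T := ⟨by linarith, hT⟩
    have hB0 : 0 ≤ B := (norm_nonneg _).trans (hB 0 h0)
    have hM0 : 0 ≤ M := (norm_nonneg _).trans (hM 0 h0)
    refine ⟨B, M, hB0, hM0, ?_⟩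
    have main : ∀ n, ∀ t ∈ Set.Icc (-T) T, ‖Y n t‖ ≤ B * (M * |t|) ^ n / n.factorial := by
      intro n
      induction n with
      | zero => intro t ht; simpa [hY0] using hB t ht
      | succ n ih =>
        intro t ht
        rw [hYs]
        have hle : ‖∫ s in (0 : ℝ)..t, C s (Y n s)‖ ≤
            ∫ s in Set.uIoc 0 t, (B * M ^ (n + 1) / n.factorial) * |s - 0| ^ n := by
          rw [intervalIntegral.norm_integral_eq_norm_integral_uIoc]
          refine norm_integral_le_of_norm_le ?_ ?_
          · exact ((by fun_prop : Continuous fun s : ℝ => (B * M ^ (n + 1) / n.factorial) *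
              |s - 0| ^ n).intervalIntegrable 0 t).def'
          · refine (ae_restrict_iff' measurableSet_uIoc).2 (Eventually.of_forall fun s hs => ?_)
            have hs' : s ∈ Set.Icc (-T) T :=
              Set.uIcc_subset_Icc h0 ht (Set.uIoc_subset_uIcc hs)
            calc ‖C s (Y n s)‖ ≤ ‖C s‖ * ‖Y n s‖ := (C s).le_opNorm _
              _ ≤ M * (B * (M * |s|) ^ n / n.factorial) := by
                gcongr
                · exact (hCm s).trans ((le_abs_self _).trans (hM s hs'))
                · exact ih s hs'
              _ = _ := by rw [sub_zero]; ring
        refine hle.trans (le_of_eq ?_)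
        rw [integral_const_mul, integral_pow_abs_sub_uIoc, sub_zero, Nat.factorial_succ]
        push_cast
        field_simp
        ring
    intro n t ht
    refine (main n t ht).trans ?_
    have : |t| ≤ T := abs_le.2 ht
    gcongr
  have hsum : ∀ T : ℝ, 0 ≤ T → ∃ u : ℕ → ℝ, Summable u ∧ ∀ n, ∀ t ∈ Set.Icc (-T) T, ‖Y n t‖ ≤ u n := by
    intro T hT
    obtain ⟨B, M, hB, hM, h⟩ := hbd T hT
    refine ⟨fun n => B * (M * T) ^ n / n.factorial, ?_, h⟩
    simpa [mul_div_assoc] using (Real.summable_pow_div_factorial (M * T)).mul_left B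
  refine ⟨fun t => ∑' n, Y n t, ?_, fun t => ?_⟩
  · refine continuous_iff_continuousAt.2 fun t => ?_
    obtain ⟨u, hu, h⟩ := hsum (|t| + 1) (by positivity)
    have := continuousOn_tsum (fun n => (Y n).continuous.continuousOn) hu h
    refine this.continuousAt (Icc_mem_nhds ?_ ?_)
    · linarith [neg_abs_le t]
    · linarith [le_abs_self t]
  · obtain ⟨u, hu, h⟩ := hsum |t| (by positivity)
    have hsub : Set.uIcc 0 t ⊆ Set.Icc (-|t|) |t| :=
      Set.uIcc_subset_Icc ⟨by simp, by simp⟩ ⟨neg_abs_le t, le_abs_self t⟩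
    have hs : ∀ s ∈ Set.Icc (-|t|) |t|, Summable fun n => Y n s := fun s hs =>
      Summable.of_norm_bounded hu fun n => h n s hs
    have h1 : HasSum (fun n => ∫ s in (0 : ℝ)..t, C s (Y n s))
        (∫ s in (0 : ℝ)..t, ∑' n, C s (Y n s)) := by
      obtain ⟨M, hM⟩ := (isCompact_uIcc (a := 0) (b := t)).exists_bound_of_continuousOn hm.continuousOn
      have hM0 : 0 ≤ M := (norm_nonneg _).trans (hM 0 Set.left_mem_uIcc)
      refine intervalIntegral.hasSum_intervalIntegral_of_summable_norm
        (f := fun n => ⟨fun s => C s (Y n s), hC _ (Y n).continuous⟩) ?_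
      refine Summable.of_nonneg_of_le (fun _ => norm_nonneg _) (fun n => ?_) (hu.mul_left M)
      refine (ContinuousMap.norm_le _ ?_).2 fun s => ?_
      · exact mul_nonneg hM0 ((norm_nonneg _).trans (h n t ⟨neg_abs_le t, le_abs_self t⟩))
      · calc ‖C s (Y n s)‖ ≤ ‖C s‖ * ‖Y n s‖ := (C s).le_opNorm _
          _ ≤ M * u n := by
            gcongr
            · exact (hCm s).trans ((le_abs_self _).trans (hM s s.2))
            · exact h n s (hsub s.2)
    have h2 : ∫ s in (0 : ℝ)..t, ∑' n, C s (Y n s) = ∫ s in (0 : ℝ)..t, C s (∑' n, Y n s) := by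
      refine intervalIntegral.integral_congr fun s hs' => ?_
      exact ((C s).map_tsum (hs s (hsub hs'))).symm
    simp only []
    rw [← h2, ← h1.tsum_eq, (hs t ⟨neg_abs_le t, le_abs_self t⟩).tsum_eq_zero_add]
    rfl

end EvolutionEquations

/-! ### Fourier multipliers on `ℓ²(ℤ; ℂ)` -/

/-- Square-summable complex sequences indexed by `ℤ`. -/
abbrev SeqL2 : Type := lp (fun _ : ℤ => ℂ) 2

section Multipliers

/-- Boundedness of a Fourier symbol. -/
def BddSymbol (m : ℤ → ℂ) : Prop := ∃ C : ℝ, ∀ k, ‖m k‖ ≤ C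

theorem SeqL2.norm_sq_eq (u : SeqL2) : ‖u‖ ^ 2 = ∑' k, ‖u k‖ ^ 2 := by
  have := lp.norm_rpow_eq_tsum (p := 2) (by norm_num) u
  simpa using this

theorem SeqL2.summable_norm_sq (u : SeqL2) : Summable fun k => ‖u k‖ ^ 2 := by
  have := (lp.memℓp u).summable (by norm_num)
  simpa using this

theorem memSeqL2_mul {m : ℤ → ℂ} (hm : BddSymbol m) (u : SeqL2) :
    Memℓp (fun k => m k * u k : ∀ _ : ℤ, ℂ) 2 := by
  obtain ⟨C, hC⟩ := hm
  refine memℓp_gen ?_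
  have h : Summable fun k => C ^ 2 * ‖u k‖ ^ 2 := u.summable_norm_sq.mul_left _
  refine Summable.of_nonneg_of_le (fun k => by positivity) (fun k => ?_) h
  simp only [ENNReal.toReal_ofNat, Real.rpow_ofNat, norm_mul, mul_pow]
  gcongr
  exact hC k

theorem norm_seq_mul_le {m : ℤ → ℂ} {C : ℝ} (hC : ∀ k, ‖m k‖ ≤ C) (u : SeqL2) :
    ‖(⟨fun k => m k * u k, memSeqL2_mul ⟨C, hC⟩ u⟩ : SeqL2)‖ ≤ C * ‖u‖ := by
  have hC0 : 0 ≤ C := (norm_nonneg _).trans (hC 0)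
  refine (sq_le_sq₀ (norm_nonneg _) (by positivity)).1 ?_
  rw [SeqL2.norm_sq_eq, mul_pow, SeqL2.norm_sq_eq, ← tsum_mul_left]
  refine Summable.tsum_le_tsum (fun k => ?_) (SeqL2.summable_norm_sq _)
    (u.summable_norm_sq.mul_left _)
  change ‖m k * u k‖ ^ 2 ≤ _
  rw [norm_mul, mul_pow]
  gcongr
  exact hC k

open Classical in
/-- The Fourier multiplier with symbol `m` on sequences (zero when `m` is unbounded). -/
noncomputable def diag (m : ℤ → ℂ) : SeqL2 →L[ℝ] SeqL2 :=
  if hm : BddSymbol m then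
    LinearMap.mkContinuousOfExistsBound
      { toFun := fun u => ⟨fun k => m k * u k, memSeqL2_mul hm u⟩
        map_add' := fun u v => by
          ext k
          exact mul_add (m k) (u k) (v k)
        map_smul' := fun r u => by
          ext k
          exact mul_smul_comm r (m k) (u k) }
      (hm.imp fun _ hC u => norm_seq_mul_le hC u)
  else 0

theorem diag_apply {m : ℤ → ℂ} (hm : BddSymbol m) (u : SeqL2) (k : ℤ) :
    diag m u k = m k * u k := by
  rw [diag, dif_pos hm]
  rfl

theorem norm_diag_apply_le {m : ℤ → ℂ} {C : ℝ} (hC : ∀ k, ‖m k‖ ≤ C) (u : SeqL2) :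
    ‖diag m u‖ ≤ C * ‖u‖ := by
  rw [diag, dif_pos ⟨C, hC⟩]
  exact norm_seq_mul_le hC u

theorem norm_diag_apply_eq {m : ℤ → ℂ} (hm : ∀ k, ‖m k‖ = 1) (u : SeqL2) : ‖diag m u‖ = ‖u‖ := by
  rw [← sq_eq_sq₀ (norm_nonneg _) (norm_nonneg _), SeqL2.norm_sq_eq, SeqL2.norm_sq_eq]
  refine tsum_congr fun k => ?_
  rw [diag_apply ⟨1, fun k => (hm k).le⟩, norm_mul, hm, one_mul]

/-- Norm continuity in time cannot be expected for oscillating symbols. Since all the operators are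
isometries, joint continuity reduces to continuity in `t` for a fixed sequence, which is dominated
convergence with majorant `4‖u k‖²`. -/
theorem continuous_diag_apply {m : ℝ → ℤ → ℂ} (hm : ∀ k, Continuous fun t => m t k)
    (h1 : ∀ t k, ‖m t k‖ = 1) : Continuous fun p : ℝ × SeqL2 => diag (m p.1) p.2 := by
  have hb : ∀ t, BddSymbol (m t) := fun t => ⟨1, fun k => (h1 t k).le⟩
  refine continuous_prod_of_continuous_lipschitzWith' _ 1 (fun t => ?_) (fun u => ?_)
  · refine LipschitzWith.of_dist_le_mul fun u v => ?_
    simp only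
    rw [dist_eq_norm, dist_eq_norm, ← map_sub, norm_diag_apply_eq (h1 t)]
    simp
  · refine continuous_iff_continuousAt.2 fun t₀ => ?_
    rw [ContinuousAt, tendsto_iff_norm_sub_tendsto_zero]
    have h2 : Tendsto (fun t => ‖diag (m t) u - diag (m t₀) u‖ ^ 2) (𝓝 t₀) (𝓝 0) := by
      have e : ∀ t, ‖diag (m t) u - diag (m t₀) u‖ ^ 2
          = ∑' k, ‖m t k - m t₀ k‖ ^ 2 * ‖u k‖ ^ 2 := by
        intro t
        rw [SeqL2.norm_sq_eq]
        refine tsum_congr fun k => ?_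
        rw [lp.coeFn_sub, Pi.sub_apply, diag_apply (hb _), diag_apply (hb _), ← sub_mul, norm_mul,
          mul_pow]
      simp only [e]
      rw [← tsum_zero (α := ℝ) (β := ℤ)]
      refine tendsto_tsum_of_dominated_convergence (bound := fun k => 2 ^ 2 * ‖u k‖ ^ 2)
        (u.summable_norm_sq.mul_left _) (fun k => ?_) (Eventually.of_forall fun t k => ?_)
      · have : Continuous fun t => ‖m t k - m t₀ k‖ ^ 2 * ‖u k‖ ^ 2 :=
          (((hm k).sub continuous_const).norm.pow 2).mul continuous_const
        simpa using this.tendsto t₀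
      · rw [Real.norm_of_nonneg (by positivity)]
        gcongr
        calc ‖m t k - m t₀ k‖ ≤ ‖m t k‖ + ‖m t₀ k‖ := norm_sub_le _ _
          _ = 2 := by rw [h1, h1]; norm_num
    have h3 := h2.sqrt
    simpa [Real.sqrt_sq (norm_nonneg _)] using h3

end Multipliers

/-! ### Modes and coefficients in a Hilbert space isometric to `ℓ²` -/

section Modes

variable {X : Type*} [NormedAddCommGroup X] [InnerProductSpace ℝ X] (Ψ : X ≃ₗᵢ[ℝ] SeqL2)

/-- The embedding of `ℂ` as the `k`-th mode. -/
noncomputable def mode (k : ℤ) : ℂ →L[ℝ] X :=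
  (Ψ.symm.toContinuousLinearEquiv : SeqL2 →L[ℝ] X).comp
    (lp.singleContinuousLinearMap ℝ (fun _ : ℤ => ℂ) 2 k)

/-- The `k`-th coefficient. -/
noncomputable def coef (k : ℤ) : X →L[ℝ] ℂ :=
  (lp.evalCLM ℝ (fun _ : ℤ => ℂ) 2 k).comp (Ψ.toContinuousLinearEquiv : X →L[ℝ] SeqL2)

/-- The operator on `X` which acts on coefficients as the multiplier `m`. -/
noncomputable def mult (m : ℤ → ℂ) : X →L[ℝ] X :=
  (Ψ.symm.toContinuousLinearEquiv : SeqL2 →L[ℝ] X).comp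
    ((diag m).comp (Ψ.toContinuousLinearEquiv : X →L[ℝ] SeqL2))

theorem mode_def (k : ℤ) (ζ : ℂ) : mode Ψ k ζ = Ψ.symm (lp.single 2 k ζ) := rfl

theorem coef_def (k : ℤ) (u : X) : coef Ψ k u = Ψ u k := rfl

theorem mult_def (m : ℤ → ℂ) (u : X) : mult Ψ m u = Ψ.symm (diag m (Ψ u)) := rfl

theorem coef_ext {u v : X} (h : ∀ k, coef Ψ k u = coef Ψ k v) : u = v :=
  Ψ.injective (lp.ext (funext h))

theorem coef_mult {m : ℤ → ℂ} (hm : BddSymbol m) (k : ℤ) (u : X) :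
    coef Ψ k (mult Ψ m u) = m k * coef Ψ k u := by
  rw [coef_def, mult_def, LinearIsometryEquiv.apply_symm_apply, diag_apply hm, coef_def]

theorem norm_mult_apply_eq {m : ℤ → ℂ} (hm : ∀ k, ‖m k‖ = 1) (u : X) : ‖mult Ψ m u‖ = ‖u‖ := by
  rw [mult_def, LinearIsometryEquiv.norm_map, norm_diag_apply_eq hm, LinearIsometryEquiv.norm_map]

theorem norm_mult_le {m : ℤ → ℂ} {C : ℝ} (hC : ∀ k, ‖m k‖ ≤ C) : ‖mult Ψ m‖ ≤ C :=
  ContinuousLinearMap.opNorm_le_bound _ ((norm_nonneg _).trans (hC 0)) fun u => by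
    rw [mult_def, LinearIsometryEquiv.norm_map, ← Ψ.norm_map u]
    exact norm_diag_apply_le hC _

theorem continuous_mult_apply {m : ℝ → ℤ → ℂ} (hm : ∀ k, Continuous fun t => m t k)
    (h1 : ∀ t k, ‖m t k‖ = 1) : Continuous fun p : ℝ × X => mult Ψ (m p.1) p.2 :=
  Ψ.symm.continuous.comp ((continuous_diag_apply hm h1).comp
    (continuous_fst.prodMk (Ψ.continuous.comp continuous_snd)))

theorem coef_mode (j k : ℤ) (ζ : ℂ) : coef Ψ j (mode Ψ k ζ) = if j = k then ζ else 0 := by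
  rw [coef_def, mode_def, LinearIsometryEquiv.apply_symm_apply, lp.single_apply]
  rcases eq_or_ne j k with rfl | h
  · simp
  · simp [h]

theorem mult_mode {m : ℤ → ℂ} (hm : BddSymbol m) (k : ℤ) (ζ : ℂ) :
    mult Ψ m (mode Ψ k ζ) = mode Ψ k (m k * ζ) := by
  refine coef_ext Ψ fun j => ?_
  rw [coef_mult Ψ hm, coef_mode, coef_mode]
  split_ifs with h
  · rw [h]
  · simp

/-- The inner product is real, so one `ζ` sees only one real component of the coefficient; `ζ = 1`
and `ζ = I` together recover it. -/
theorem inner_mode (u : X) (k : ℤ) (ζ : ℂ) :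
    inner ℝ u (mode Ψ k ζ) = (coef Ψ k u * conj ζ).re := by
  rw [mode_def, ← Ψ.inner_map_map, LinearIsometryEquiv.apply_symm_apply]
  rw [lp.inner_single_right (𝕜 := ℝ), coef_def, Complex.inner, mul_comm, ← Complex.conj_re]
  simp [mul_comm]

/-- The projection to the modes in a finite set. -/
noncomputable def modeProj (s : Finset ℤ) : X →L[ℝ] X := ∑ k ∈ s, (mode Ψ k).comp (coef Ψ k)

theorem coef_modeProj (s : Finset ℤ) (j : ℤ) (u : X) :
    coef Ψ j (modeProj Ψ s u) = if j ∈ s then coef Ψ j u else 0 := by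
  simp [modeProj, coef_mode]

theorem norm_modeProj_apply_le (s : Finset ℤ) (u : X) : ‖modeProj Ψ s u‖ ≤ ‖u‖ := by
  have hm : ∀ k, ‖(fun k => if k ∈ s then 1 else 0 : ℤ → ℂ) k‖ ≤ 1 := by
    intro k
    simp only
    split_ifs <;> simp
  have : modeProj Ψ s u = mult Ψ (fun k => if k ∈ s then 1 else 0) u := by
    refine coef_ext Ψ fun j => ?_
    rw [coef_modeProj, coef_mult Ψ ⟨1, hm⟩]
    split_ifs <;> simp
  rw [this]
  simpa using (mult Ψ _).le_of_opNorm_le (norm_mult_le Ψ hm) u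

theorem tendsto_modeProj (u : X) : Tendsto (fun s => modeProj Ψ s u) atTop (𝓝 u) := by
  have h := lp.hasSum_single (E := fun _ : ℤ => ℂ) (p := 2) (by norm_num) (Ψ u)
  have h2 := (Ψ.symm.continuous.tendsto _).comp h
  rw [LinearIsometryEquiv.symm_apply_apply] at h2
  refine h2.congr fun s => ?_
  simp [modeProj, mode_def, coef_def]

end Modes

theorem _root_.HasDerivAt.of_eq {E : Type*} [NormedAddCommGroup E] [NormedSpace ℝ E] {f g : ℝ → E}
    {f' g' : E} {x : ℝ} (h : HasDerivAt f f' x) (hf : ∀ t, g t = f t) (hf' : g' = f') :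
    HasDerivAt g g' x := by
  rw [funext hf, hf']
  exact h

/-! ### Existence and uniqueness from an abstract conjugator -/

section Conjugation

variable {X : Type*} [NormedAddCommGroup X] [InnerProductSpace ℝ X]

/-- A time-dependent conjugating operator `1 + S`, close to the identity and `C¹` in time, together
with the symbol `i lam` of a diagonal skew-adjoint operator and a bounded remainder `R`. -/
structure Conjugator (X : Type*) [NormedAddCommGroup X] [InnerProductSpace ℝ X] where
  S : ℝ → X →L[ℝ] X
  S' : ℝ → X →L[ℝ] X
  R : ℝ → X →L[ℝ] X
  lam : ℤ → ℝ → ℝ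
  hasDerivAt_S : ∀ t, HasDerivAt S (S' t) t
  continuous_S' : Continuous S'
  continuous_R : Continuous R
  continuous_lam : ∀ k, Continuous (lam k)
  norm_S_le : ∀ t, ‖S t‖ ≤ 1 / 2

namespace Conjugator

variable (K : Conjugator X)

/-- The conjugating operator `1 + S`. -/
noncomputable def T (t : ℝ) : X →L[ℝ] X := 1 + K.S t

/-- The accumulated phase of the `k`-th mode. -/
noncomputable def phase (k : ℤ) (t : ℝ) : ℝ := ∫ s in (0 : ℝ)..t, K.lam k s

/-- The symbol of the evolution generated by the diagonal operator. -/
noncomputable def symb (t : ℝ) (k : ℤ) : ℂ := Complex.exp (K.phase k t * Complex.I)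

theorem continuous_S : Continuous K.S :=
  continuous_iff_continuousAt.2 fun t => (K.hasDerivAt_S t).continuousAt

theorem continuous_T : Continuous K.T := continuous_const.add K.continuous_S

theorem hasDerivAt_T (t : ℝ) : HasDerivAt K.T (K.S' t) t := (K.hasDerivAt_S t).const_add 1

theorem hasDerivAt_symb (k : ℤ) (t : ℝ) :
    HasDerivAt (fun t => K.symb t k) (K.symb t k * (K.lam k t * Complex.I)) t := by
  have h : HasDerivAt (K.phase k) (K.lam k t) t :=
    intervalIntegral.integral_hasDerivAt_right ((K.continuous_lam k).intervalIntegrable _ _)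
      (K.continuous_lam k).stronglyMeasurable.stronglyMeasurableAtFilter
      (K.continuous_lam k).continuousAt
  exact (h.ofReal_comp.mul_const Complex.I).cexp

theorem norm_symb (t : ℝ) (k : ℤ) : ‖K.symb t k‖ = 1 := Complex.norm_exp_ofReal_mul_I _

theorem symb_zero (k : ℤ) : K.symb 0 k = 1 := by simp [symb, phase]

theorem continuous_symb (k : ℤ) : Continuous fun t => K.symb t k :=
  continuous_iff_continuousAt.2 fun t => (K.hasDerivAt_symb k t).continuousAt

theorem bddSymbol_symb (t : ℝ) : BddSymbol (K.symb t) := ⟨1, fun k => (K.norm_symb t k).le⟩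

theorem symb_mul_conj (t : ℝ) (k : ℤ) : K.symb t k * conj (K.symb t k) = 1 := by
  rw [Complex.mul_conj, Complex.normSq_eq_norm_sq, norm_symb]
  simp

theorem norm_conj_symb (t : ℝ) (k : ℤ) : ‖conj (K.symb t k)‖ = 1 := by
  rw [RCLike.norm_conj, norm_symb]

theorem bddSymbol_conj_symb (t : ℝ) : BddSymbol fun k => conj (K.symb t k) :=
  ⟨1, fun k => (K.norm_conj_symb t k).le⟩

theorem hasDerivAt_conj_symb (k : ℤ) (t : ℝ) :
    HasDerivAt (fun t => conj (K.symb t k)) (conj (K.symb t k) * (-(K.lam k t * Complex.I))) t := by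
  have := Complex.conjCLE.toContinuousLinearMap.hasFDerivAt.comp_hasDerivAt t (K.hasDerivAt_symb k t)
  simpa [Function.comp_def] using this

variable (Ψ : X ≃ₗᵢ[ℝ] SeqL2)

/-- The evolution generated by the diagonal operator. -/
noncomputable def U (t : ℝ) : X →L[ℝ] X := mult Ψ (K.symb t)

/-- The inverse of the evolution generated by the diagonal operator. -/
noncomputable def V (t : ℝ) : X →L[ℝ] X := mult Ψ fun k => conj (K.symb t k)

theorem coef_U (t : ℝ) (k : ℤ) (u : X) : coef Ψ k (K.U Ψ t u) = K.symb t k * coef Ψ k u :=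
  coef_mult Ψ (K.bddSymbol_symb t) k u

theorem coef_V (t : ℝ) (k : ℤ) (u : X) : coef Ψ k (K.V Ψ t u) = conj (K.symb t k) * coef Ψ k u :=
  coef_mult Ψ (K.bddSymbol_conj_symb t) k u

theorem U_V (t : ℝ) (u : X) : K.U Ψ t (K.V Ψ t u) = u :=
  coef_ext Ψ fun k => by rw [coef_U, coef_V, ← mul_assoc, symb_mul_conj, one_mul]

theorem U_zero (u : X) : K.U Ψ 0 u = u :=
  coef_ext Ψ fun k => by rw [coef_U, symb_zero, one_mul]

theorem norm_U (t : ℝ) (u : X) : ‖K.U Ψ t u‖ = ‖u‖ := norm_mult_apply_eq Ψ (K.norm_symb t) u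

theorem norm_V (t : ℝ) (u : X) : ‖K.V Ψ t u‖ = ‖u‖ := norm_mult_apply_eq Ψ (K.norm_conj_symb t) u

theorem continuous_U : Continuous fun p : ℝ × X => K.U Ψ p.1 p.2 :=
  continuous_mult_apply Ψ (m := K.symb) K.continuous_symb K.norm_symb

theorem continuous_V : Continuous fun p : ℝ × X => K.V Ψ p.1 p.2 :=
  continuous_mult_apply Ψ (m := fun t k => conj (K.symb t k))
    (fun k => Complex.continuous_conj.comp (K.continuous_symb k)) K.norm_conj_symb

theorem continuous_U_apply {b : ℝ → X} (hb : Continuous b) :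
    Continuous fun t => K.U Ψ t (b t) := by
  have h := (K.continuous_U Ψ).comp (continuous_id'.prodMk hb)
  exact h

theorem continuous_V_apply {b : ℝ → X} (hb : Continuous b) :
    Continuous fun t => K.V Ψ t (b t) := by
  have h := (K.continuous_V Ψ).comp (continuous_id'.prodMk hb)
  exact h

/-- As `φ` vanishes at `s`, the difference quotient is the pairing of `w t` with the slope of `φ`,
so continuity of `w` suffices. It handles the variation of `T` in the pairing of a merely weak
solution with `T t` applied to a mode. -/
theorem hasDerivAt_inner_of_eq_zero {w φ : ℝ → X} {φ' : X} {s : ℝ} (hw : ContinuousAt w s)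
    (hφ : HasDerivAt φ φ' s) (h0 : φ s = 0) :
    HasDerivAt (fun t => inner ℝ (w t) (φ t)) (inner ℝ (w s) φ') s := by
  rw [hasDerivAt_iff_tendsto_slope] at hφ ⊢
  have h := (hw.tendsto.mono_left nhdsWithin_le_nhds).inner (𝕜 := ℝ) hφ
  refine h.congr fun t => ?_
  simp [slope_def_module, h0, inner_smul_right]

variable [CompleteSpace X]

/-- A continuous curve that weakly solves the homogeneous equation, tested on the conjugated modes,
vanishes if it vanishes at time `0`. -/
theorem eq_zero_of_weak {w : ℝ → X} (hw : Continuous w) (h0 : w 0 = 0)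
    (hmode : ∀ k ζ s, HasDerivAt (fun t => inner ℝ (w t) (K.T s (mode Ψ k ζ)))
      (-inner ℝ (w s) (K.T s (mode Ψ k (K.lam k s * Complex.I * ζ)) + K.R s (mode Ψ k ζ))) s)
    (t : ℝ) : w t = 0 := by
  -- Let `Λ` be the diagonal operator with symbol `i lam`. Its adjoint is `-Λ`, so `v = T* w` solves
  -- `v' = Λ v + b` coefficient by coefficient, and `b` is controlled by `‖w‖`.
  set v : ℝ → X := fun t => ContinuousLinearMap.adjoint (K.T t) (w t) with hv
  set b : ℝ → X := fun t => ContinuousLinearMap.adjoint (K.S' t - K.R t) (w t) with hb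
  have hbc : Continuous b := by
    have : Continuous fun t => ContinuousLinearMap.adjoint (K.S' t - K.R t) :=
      ContinuousLinearMap.adjoint.continuous.comp (K.continuous_S'.sub K.continuous_R)
    exact this.clm_apply hw
  have hinner : ∀ k ζ s, HasDerivAt (fun t => inner ℝ (v t) (mode Ψ k ζ))
      (inner ℝ (b s) (mode Ψ k ζ) - inner ℝ (v s) (mode Ψ k (K.lam k s * Complex.I * ζ))) s := by
    intro k ζ s
    have h1 := hmode k ζ s
    have h2 : HasDerivAt (fun t => inner ℝ (w t) (K.T t (mode Ψ k ζ) - K.T s (mode Ψ k ζ)))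
        (inner ℝ (w s) (K.S' s (mode Ψ k ζ))) s := by
      refine hasDerivAt_inner_of_eq_zero hw.continuousAt ?_ (sub_self _)
      simpa using ((K.hasDerivAt_T s).clm_apply (hasDerivAt_const s (mode Ψ k ζ))).sub_const
        (K.T s (mode Ψ k ζ))
    refine (h1.add h2).of_eq (fun t => ?_) ?_
    · simp [hv, ContinuousLinearMap.adjoint_inner_left, inner_sub_right]
    · simp only [hv, hb, ContinuousLinearMap.adjoint_inner_left, sub_apply,
        inner_sub_right, inner_add_right]
      ring
  have hcoef : ∀ k s, HasDerivAt (fun t => coef Ψ k (v t))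
      (coef Ψ k (b s) + K.lam k s * Complex.I * coef Ψ k (v s)) s := by
    intro k s
    have hre := hinner k 1 s
    have him := hinner k Complex.I s
    simp only [inner_mode] at hre him
    refine (hre.ofReal_comp.add (him.ofReal_comp.mul_const Complex.I)).of_eq (fun t => ?_) ?_
    · apply Complex.ext <;> simp
    · apply Complex.ext <;> simp <;> ring
  -- Undoing the diagonal evolution removes the unbounded term: each coefficient of `y` has
  -- derivative that of `V b`, and the integrated identity makes `y` differentiable in norm.
  set y : ℝ → X := fun t => K.V Ψ t (v t) with hy
  have hy' : ∀ t, y t = ∫ s in (0 : ℝ)..t, K.V Ψ s (b s) := by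
    intro t
    have hc : Continuous fun s => K.V Ψ s (b s) := K.continuous_V_apply Ψ hbc
    refine coef_ext Ψ fun k => ?_
    rw [← (coef Ψ k).intervalIntegral_comp_comm (hc.intervalIntegrable _ _)]
    have hd : ∀ s, HasDerivAt (fun t => coef Ψ k (y t)) (coef Ψ k (K.V Ψ s (b s))) s := by
      intro s
      simp only [hy, coef_V]
      refine ((K.hasDerivAt_conj_symb k s).mul (hcoef k s)).of_eq (fun t => rfl) ?_
      ring
    rw [intervalIntegral.integral_eq_sub_of_hasDerivAt (fun s _ => hd s)
      (((coef Ψ k).continuous.comp hc).intervalIntegrable _ _)]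
    simp [hy, hv, h0]
  have hderiv : ∀ t, HasDerivAt y (K.V Ψ t (b t)) t := by
    intro t
    have hc : Continuous fun s => K.V Ψ s (b s) := K.continuous_V_apply Ψ hbc
    rw [funext hy']
    exact intervalIntegral.integral_hasDerivAt_right (hc.intervalIntegrable _ _)
      hc.stronglyMeasurable.stronglyMeasurableAtFilter hc.continuousAt
  -- `‖S‖ ≤ 1/2` bounds `T* = 1 + S*` from below by `1/2`, which closes the differential inequality
  -- in terms of `y` alone.
  have hwy : ∀ t, ‖w t‖ ≤ 2 * ‖y t‖ := by
    intro t
    rw [hy, norm_V]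
    have h1 : v t = w t + ContinuousLinearMap.adjoint (K.S t) (w t) := by
      simp only [hv, T, map_add, add_apply, ← ContinuousLinearMap.star_eq_adjoint, star_one]
      rfl
    have h2 : ‖ContinuousLinearMap.adjoint (K.S t) (w t)‖ ≤ 1 / 2 * ‖w t‖ :=
      ContinuousLinearMap.le_of_opNorm_le _
        (by rw [LinearIsometryEquiv.norm_map]; exact K.norm_S_le t) _
    have h3 : ‖w t‖ ≤ ‖v t‖ + ‖ContinuousLinearMap.adjoint (K.S t) (w t)‖ := by
      have := norm_sub_le (v t) (ContinuousLinearMap.adjoint (K.S t) (w t))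
      rwa [h1, add_sub_cancel_right, ← h1] at this
    linarith
  have hy0 : y t = 0 := by
    refine eq_zero_of_norm_deriv_le (m := fun t => 2 * ‖K.S' t - K.R t‖) hderiv
      (by have := K.continuous_S'; have := K.continuous_R; fun_prop) (fun t => ?_)
      (by simp [hy']) t
    rw [norm_V]
    calc ‖b t‖ ≤ ‖K.S' t - K.R t‖ * ‖w t‖ :=
          ContinuousLinearMap.le_of_opNorm_le _ (by rw [LinearIsometryEquiv.norm_map]) _
      _ ≤ ‖K.S' t - K.R t‖ * (2 * ‖y t‖) := by gcongr; exact hwy t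
      _ = _ := by ring
  have := hwy t
  rw [hy0] at this
  simpa using this

/-- The inverse of `1 + S`. -/
noncomputable def Tinv (t : ℝ) : X →L[ℝ] X := Ring.inverse (K.T t)

theorem isUnit_T (t : ℝ) : IsUnit (K.T t) := by
  have : ‖-K.S t‖ < 1 := by
    rw [norm_neg]
    linarith [K.norm_S_le t]
  simpa [T] using isUnit_one_sub_of_norm_lt_one this

theorem T_Tinv (t : ℝ) (u : X) : K.T t (K.Tinv t u) = u :=
  congrArg (fun A : X →L[ℝ] X => A u) (Ring.mul_inverse_cancel _ (K.isUnit_T t))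

theorem continuous_Tinv : Continuous K.Tinv := by
  refine continuous_iff_continuousAt.2 fun t => ?_
  obtain ⟨u, hu⟩ := K.isUnit_T t
  exact ContinuousAt.comp (f := K.T) (g := Ring.inverse) (hu ▸ NormedRing.inverse_continuousAt u)
    K.continuous_T.continuousAt

omit [InnerProductSpace ℝ X] [CompleteSpace X] in
theorem _root_.MeasureTheory.LocallyIntegrable.clm_apply [NormedSpace ℝ X] {A : ℝ → X →L[ℝ] X}
    (hA : Continuous A) {h : ℝ → X} (hh : LocallyIntegrable h volume) :
    LocallyIntegrable (fun t => A t (h t)) volume := by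
  rw [locallyIntegrable_iff] at hh ⊢
  intro k hk
  obtain ⟨M, hM⟩ := hk.exists_bound_of_continuousOn hA.continuousOn
  refine ((hh k hk).norm.const_mul M).mono' ?_ ?_
  · exact (isBoundedBilinearMap_apply (𝕜 := ℝ) (E := X) (F := X)).continuous.comp_aestronglyMeasurable
      (hA.aestronglyMeasurable.prodMk (hh k hk).aestronglyMeasurable)
  · refine (ae_restrict_iff' hk.measurableSet).2 (Eventually.of_forall fun s hs => ?_)
    exact (A s).le_of_opNorm_le (hM s hs) _

omit [CompleteSpace X] in
theorem integrable_V_apply {h : ℝ → X} (hh : LocallyIntegrable h volume) :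
    LocallyIntegrable (fun t => K.V Ψ t (h t)) volume := by
  refine hh.mono ?_ (Eventually.of_forall fun t => (K.norm_V Ψ t (h t)).le)
  have h := (K.continuous_V Ψ).comp_aestronglyMeasurable
    (aestronglyMeasurable_id.prodMk hh.aestronglyMeasurable)
  exact h

/-- A mode-by-mode construction of a solution of the inhomogeneous equation, tested against all
`φ` whose image `φs` under the adjoint operator is compatible with the conjugation. -/
theorem exists_weak_solution {h : ℝ → X} (hh : LocallyIntegrable h volume) (w₀ : X) :
    ∃ w : ℝ → X, Continuous w ∧ w 0 = w₀ ∧ ∀ (φ : X) (φs : ℝ → X), Continuous φs →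
      (∀ k ζ t, inner ℝ (K.T t (mode Ψ k (K.lam k t * Complex.I * ζ)) + K.R t (mode Ψ k ζ)) φ
        = -inner ℝ (K.T t (mode Ψ k ζ)) (φs t)) →
      ∀ t, inner ℝ (w t) φ - inner ℝ (w 0) φ
        = ∫ s in (0 : ℝ)..t, (inner ℝ (h s) φ - inner ℝ (w s) (φs s)) := by
  have hSR : Continuous fun t => K.S' t - K.R t := K.continuous_S'.sub K.continuous_R
  -- With `w = T v` and `L T = T Λ + R`, the equation becomes `v' = Λ v - T⁻¹(S' - R) v + T⁻¹ h`.
  -- For `y = V v` this is a Volterra equation with the bounded kernel `C = -V A U` and forcing `V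
  -- p`.
  set A : ℝ → X →L[ℝ] X := fun t => (K.Tinv t).comp (K.S' t - K.R t) with hA
  have hAc : Continuous A := K.continuous_Tinv.clm_comp hSR
  set C : ℝ → X →L[ℝ] X := fun t => -((K.V Ψ t).comp ((A t).comp (K.U Ψ t))) with hC
  set p : ℝ → X := fun t => K.Tinv t (h t) with hp
  have hpi : LocallyIntegrable p volume := hh.clm_apply K.continuous_Tinv
  have hVp := K.integrable_V_apply Ψ hpi
  have hVpi : ∀ a b : ℝ, IntervalIntegrable (fun s => K.V Ψ s (p s)) volume a b := fun a b =>
    (hVp.integrableOn_isCompact isCompact_uIcc).intervalIntegrable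
  set v₀ : X := K.Tinv 0 w₀ with hv₀
  have hCy : ∀ y : ℝ → X, Continuous y → Continuous fun t => C t (y t) := fun y hy =>
    (K.continuous_V_apply Ψ (hAc.clm_apply (K.continuous_U_apply Ψ hy))).neg
  obtain ⟨y, hyc, hy⟩ := exists_volterra_solution (C := C) (m := fun t => ‖A t‖) hCy hAc.norm
    (fun t => ContinuousLinearMap.opNorm_le_bound _ (norm_nonneg _) fun u => by
      rw [hC]
      simp only [neg_apply, norm_neg, ContinuousLinearMap.comp_apply, norm_V]
      refine ((A t).le_opNorm _).trans_eq ?_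
      rw [norm_U])
    (f := fun t => v₀ + ∫ s in (0 : ℝ)..t, K.V Ψ s (p s))
    (continuous_const.add (intervalIntegral.continuous_primitive hVpi 0))
  set v : ℝ → X := fun t => K.U Ψ t (y t) with hv
  have hvc : Continuous v := K.continuous_U_apply Ψ hyc
  set g : ℝ → X := fun t => p t - A t (v t) with hg
  have hgi : LocallyIntegrable g volume := hpi.sub (hAc.clm_apply hvc).locallyIntegrable
  have hVg := K.integrable_V_apply Ψ hgi
  have hVgi : ∀ a b : ℝ, IntervalIntegrable (fun s => K.V Ψ s (g s)) volume a b := fun a b =>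
    (hVg.integrableOn_isCompact isCompact_uIcc).intervalIntegrable
  have hy2 : ∀ t, y t = v₀ + ∫ s in (0 : ℝ)..t, K.V Ψ s (g s) := by
    intro t
    rw [hy t, add_assoc, ← intervalIntegral.integral_add (hVpi _ _)
      ((hCy y hyc).intervalIntegrable _ _)]
    congr 1
    refine intervalIntegral.integral_congr fun s _ => ?_
    simp [hC, hg, hv, sub_eq_add_neg]
  have hgeq : ∀ t, K.T t (g t) = h t - (K.S' t - K.R t) (v t) := by
    intro t
    simp only [hg, hp, hA, map_sub, ContinuousLinearMap.comp_apply, T_Tinv]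
  have hv0 : v 0 = v₀ := by simp [hv, U_zero, hy2 0]
  refine ⟨fun t => K.T t (v t), K.continuous_T.clm_apply hvc, ?_, ?_⟩
  · simp only [hv0, hv₀, T_Tinv]
  intro φ φs hφs hcomp t
  have hcv : ∀ k s, coef Ψ k (v s) = K.symb s k * coef Ψ k (y s) := fun k s => K.coef_U Ψ s k (y s)
  have hint : ∀ {q : ℝ → X}, LocallyIntegrable q volume → ∀ a b, IntervalIntegrable q volume a b :=
    fun hq a b => (hq.integrableOn_isCompact isCompact_uIcc).intervalIntegrable
  -- `v` need not lie in the domain of `Λ`, so the time derivative is computed on one mode at a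
  -- time, where the product rule applies; the compatibility hypothesis then trades `lam k` for
  -- `φs`.
  have hmode : ∀ k : ℤ,
      inner ℝ (K.T t (mode Ψ k (coef Ψ k (v t)))) φ - inner ℝ (K.T 0 (mode Ψ k (coef Ψ k (v 0)))) φ
        = ∫ s in (0 : ℝ)..t, (inner ℝ ((K.S' s - K.R s) (mode Ψ k (coef Ψ k (v s)))
            + K.T s (mode Ψ k (coef Ψ k (g s)))) φ
          - inner ℝ (K.T s (mode Ψ k (coef Ψ k (v s)))) (φs s)) := by
    intro k
    set Q : ℝ → ℂ →L[ℝ] X := fun t =>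
      (K.T t).comp ((mode Ψ k).comp (ContinuousLinearMap.mul ℝ ℂ (K.symb t k))) with hQ
    set Q' : ℝ → ℂ →L[ℝ] X := fun t =>
      (K.S' t).comp ((mode Ψ k).comp (ContinuousLinearMap.mul ℝ ℂ (K.symb t k)))
      + (K.T t).comp ((mode Ψ k).comp
          (ContinuousLinearMap.mul ℝ ℂ (K.symb t k * (K.lam k t * Complex.I)))) with hQ'
    have hQd : ∀ t, HasDerivAt Q (Q' t) t := fun t => by
      have h1 := (ContinuousLinearMap.mul ℝ ℂ).hasFDerivAt.comp_hasDerivAt t (K.hasDerivAt_symb k t)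
      have h2 := (hasDerivAt_const t (mode Ψ k)).clm_comp h1
      refine ((K.hasDerivAt_T t).clm_comp h2).of_eq (fun t => rfl) ?_
      simp [hQ']
    have hQ'c : Continuous Q' := by
      have h1 := (ContinuousLinearMap.mul ℝ ℂ).continuous.comp (K.continuous_symb k)
      have h2 : Continuous fun t => K.symb t k * (K.lam k t * Complex.I) :=
        (K.continuous_symb k).mul
          ((Complex.continuous_ofReal.comp (K.continuous_lam k)).mul continuous_const)
      have h3 := (ContinuousLinearMap.mul ℝ ℂ).continuous.comp h2
      exact (K.continuous_S'.clm_comp (continuous_const.clm_comp h1)).add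
        (K.continuous_T.clm_comp (continuous_const.clm_comp h3))
    have hcg : LocallyIntegrable (fun s => coef Ψ k (K.V Ψ s (g s))) volume := by
      rw [locallyIntegrable_iff]
      exact fun c hc => (coef Ψ k).integrable_comp (hVg.integrableOn_isCompact hc)
    have hyk : ∀ s, coef Ψ k (y s) = coef Ψ k v₀ + ∫ r in (0 : ℝ)..s, coef Ψ k (K.V Ψ r (g r)) := by
      intro s
      rw [hy2 s, map_add, (coef Ψ k).intervalIntegral_comp_comm (hVgi _ _)]
    have hprod := clm_apply_primitive hQd hQ'c hcg (coef Ψ k v₀) t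
    simp only [← hyk] at hprod
    have hQy : ∀ s, Q s (coef Ψ k (y s)) = K.T s (mode Ψ k (coef Ψ k (v s))) := fun s => by
      rw [hcv]
      rfl
    have hy0 : coef Ψ k v₀ = coef Ψ k (y 0) := by simp [hy2 0]
    have hint2 : IntervalIntegrable (fun s => Q' s (coef Ψ k (y s)) + Q s (coef Ψ k (K.V Ψ s (g s))))
        volume 0 t := by
      have hQc : Continuous Q := continuous_iff_continuousAt.2 fun t => (hQd t).continuousAt
      have h1 : Continuous fun s => Q' s (coef Ψ k (y s)) :=
        hQ'c.clm_apply ((coef Ψ k).continuous.comp hyc)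
      have h2 : (fun s => Q s (coef Ψ k (K.V Ψ s (g s))))
          = fun s => K.T s (mode Ψ k (coef Ψ k (g s))) := by
        funext s
        change K.T s (mode Ψ k (K.symb s k * coef Ψ k (K.V Ψ s (g s)))) = _
        rw [← coef_U, U_V]
      refine (h1.intervalIntegrable _ _).add (hint ?_ _ _)
      rw [h2]
      exact hgi.clm_apply (A := fun s => (K.T s).comp ((mode Ψ k).comp (coef Ψ k)))
        (K.continuous_T.clm_comp continuous_const)
    rw [hQy, hy0, hQy] at hprod
    rw [hprod, inner_add_left, add_sub_cancel_left, real_inner_comm]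
    rw [← innerSL_apply_apply ℝ φ, ← (innerSL ℝ φ).intervalIntegral_comp_comm hint2]
    refine intervalIntegral.integral_congr fun s _ => ?_
    have e1 : Q s (coef Ψ k (K.V Ψ s (g s))) = K.T s (mode Ψ k (coef Ψ k (g s))) := by
      change K.T s (mode Ψ k (K.symb s k * coef Ψ k (K.V Ψ s (g s)))) = _
      rw [← coef_U, U_V]
    have e2 : Q' s (coef Ψ k (y s)) = K.S' s (mode Ψ k (coef Ψ k (v s)))
        + K.T s (mode Ψ k (K.lam k s * Complex.I * coef Ψ k (v s))) := by
      rw [hcv]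
      change K.S' s (mode Ψ k (K.symb s k * coef Ψ k (y s)))
        + K.T s (mode Ψ k (K.symb s k * (K.lam k s * Complex.I) * coef Ψ k (y s))) = _
      ring_nf
    have e3 := hcomp k (coef Ψ k (v s)) s
    have e4 : ∀ z : X, innerSL ℝ φ z = inner ℝ z φ := fun z => by
      rw [innerSL_apply_apply, real_inner_comm]
    simp only [e4, e1, e2]
    rw [inner_add_left] at e3
    simp only [inner_add_left, sub_apply, inner_sub_left]
    linarith
  have hDint : ∀ a b : ℝ → X, Continuous a → LocallyIntegrable b volume →
      IntervalIntegrable (fun s => inner ℝ ((K.S' s - K.R s) (a s) + K.T s (b s)) φ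
        - inner ℝ (K.T s (a s)) (φs s)) volume 0 t := by
    intro a b ha hb
    have h1 : IntervalIntegrable (fun s => (K.S' s - K.R s) (a s) + K.T s (b s)) volume 0 t :=
      hint ((hSR.clm_apply ha).locallyIntegrable.add (hb.clm_apply K.continuous_T)) _ _
    have h2 : IntervalIntegrable (fun s => inner ℝ ((K.S' s - K.R s) (a s) + K.T s (b s)) φ)
        volume 0 t := ⟨h1.1.inner_const φ, h1.2.inner_const φ⟩
    exact h2.sub (((K.continuous_T.clm_apply ha).inner hφs).intervalIntegrable _ _)
  have hsum : ∀ F : Finset ℤ,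
      inner ℝ (K.T t (modeProj Ψ F (v t))) φ - inner ℝ (K.T 0 (modeProj Ψ F (v 0))) φ
        = ∫ s in (0 : ℝ)..t, (inner ℝ ((K.S' s - K.R s) (modeProj Ψ F (v s))
            + K.T s (modeProj Ψ F (g s))) φ
          - inner ℝ (K.T s (modeProj Ψ F (v s))) (φs s)) := by
    intro F
    have e : ∀ u, modeProj Ψ F u = ∑ k ∈ F, mode Ψ k (coef Ψ k u) := fun u => by simp [modeProj]
    simp only [e, map_sum, sum_inner, ← Finset.sum_add_distrib, ← Finset.sum_sub_distrib, hmode]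
    rw [intervalIntegral.integral_finsetSum]
    intro k _
    refine hDint _ _ ((mode Ψ k).continuous.comp ((coef Ψ k).continuous.comp hvc)) ?_
    exact hgi.clm_apply (A := fun _ => (mode Ψ k).comp (coef Ψ k)) continuous_const
  -- No `lam k` is left, only bounded operators acting on `v` and `g`, so finite sums of modes pass
  -- to the limit by dominated convergence.
  have hlim : Tendsto (fun F : Finset ℤ => ∫ s in (0 : ℝ)..t,
      (inner ℝ ((K.S' s - K.R s) (modeProj Ψ F (v s)) + K.T s (modeProj Ψ F (g s))) φ
        - inner ℝ (K.T s (modeProj Ψ F (v s))) (φs s))) atTop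
      (𝓝 (∫ s in (0 : ℝ)..t, (inner ℝ ((K.S' s - K.R s) (v s) + K.T s (g s)) φ
        - inner ℝ (K.T s (v s)) (φs s)))) := by
    refine intervalIntegral.tendsto_integral_filter_of_dominated_convergence
      (fun s => (‖K.S' s - K.R s‖ * ‖v s‖ + ‖K.T s‖ * ‖g s‖) * ‖φ‖ + ‖K.T s‖ * ‖v s‖ * ‖φs s‖)
      (Eventually.of_forall fun F => ?_) (Eventually.of_forall fun F => ?_) ?_ ?_
    · exact (hDint _ _ ((modeProj Ψ F).continuous.comp hvc) (hgi.clm_apply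
        (A := fun _ => modeProj Ψ F) continuous_const)).def'.aestronglyMeasurable
    · refine Eventually.of_forall fun s _ => (norm_sub_le _ _).trans ?_
      have h1 := norm_modeProj_apply_le Ψ F (v s)
      have h2 := norm_modeProj_apply_le Ψ F (g s)
      gcongr
      · refine (norm_inner_le_norm _ _).trans ?_
        gcongr
        refine (norm_add_le _ _).trans ?_
        gcongr
        · exact ((K.S' s - K.R s).le_opNorm _).trans (by gcongr)
        · exact ((K.T s).le_opNorm _).trans (by gcongr)
      · refine (norm_inner_le_norm _ _).trans ?_
        gcongr
        exact ((K.T s).le_opNorm _).trans (by gcongr)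
    · have h1 : IntervalIntegrable (fun s => ‖K.T s‖ * ‖g s‖) volume 0 t :=
        (hint hgi 0 t).norm.continuousOn_mul K.continuous_T.norm.continuousOn
      have h2 : IntervalIntegrable (fun s => ‖K.S' s - K.R s‖ * ‖v s‖) volume 0 t :=
        (hSR.norm.mul hvc.norm).intervalIntegrable _ _
      exact ((h2.add h1).mul_const _).add
        (((K.continuous_T.norm.mul hvc.norm).mul hφs.norm).intervalIntegrable _ _)
    · refine Eventually.of_forall fun s _ => ?_
      have h1 := tendsto_modeProj Ψ (v s)
      have h2 := tendsto_modeProj Ψ (g s)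
      exact (((((K.S' s - K.R s).continuous.tendsto _).comp h1).add
        (((K.T s).continuous.tendsto _).comp h2)).inner tendsto_const_nhds).sub
        ((((K.T s).continuous.tendsto _).comp h1).inner tendsto_const_nhds)
  simp only [← hsum] at hlim
  have hlim2 : Tendsto (fun F : Finset ℤ => inner ℝ (K.T t (modeProj Ψ F (v t))) φ
      - inner ℝ (K.T 0 (modeProj Ψ F (v 0))) φ) atTop
      (𝓝 (inner ℝ (K.T t (v t)) φ - inner ℝ (K.T 0 (v 0)) φ)) :=
    ((((K.T t).continuous.tendsto _).comp (tendsto_modeProj Ψ (v t))).inner tendsto_const_nhds).sub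
      ((((K.T 0).continuous.tendsto _).comp (tendsto_modeProj Ψ (v 0))).inner tendsto_const_nhds)
  rw [tendsto_nhds_unique hlim2 hlim]
  refine intervalIntegral.integral_congr fun s _ => ?_
  simp only [hgeq, add_sub_cancel]

end Conjugator

end Conjugation

end DispersiveTorus

namespace DispersiveTorus

open scoped ComplexConjugate ENNReal

/-! ### The Fourier basis for the measure of total mass `2π` -/

section FourierBasis

/-- Trigonometric polynomials are uniformly dense in the continuous functions, and these are dense
in `L²`. -/
theorem span_fourier_toLp_closure_eq_top :
    (Submodule.span ℂ (Set.range fun k : ℤ =>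
      ContinuousMap.toLp (E := ℂ) 2 (volume : Measure Torus) ℂ (fourier k))).topologicalClosure = ⊤ := by
  convert! (ContinuousMap.toLp_denseRange ℂ (volume : Measure Torus) ℂ
    (p := 2) (by norm_num)).topologicalClosure_map_submodule span_fourier_closure_eq_top
  rw [Submodule.map_span]
  rw [Set.range_comp']
  simp only [ContinuousLinearMap.coe_coe]

/-- The normalisation constant of the trigonometric system in `L²(0, 2π)`. -/
noncomputable def nrm : ℝ := (Real.sqrt (2 * Real.pi))⁻¹

theorem nrm_pos : 0 < nrm := by
  have := Real.pi_pos
  unfold nrm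
  positivity

theorem nrm_sq_mul : nrm * nrm * (2 * Real.pi) = 1 := by
  have := Real.pi_pos
  have h : Real.sqrt (2 * Real.pi) * Real.sqrt (2 * Real.pi) = 2 * Real.pi :=
    Real.mul_self_sqrt (by positivity)
  have h2 : Real.sqrt (2 * Real.pi) ≠ 0 := by positivity
  unfold nrm
  nth_rewrite 3 [← h]
  field_simp

/-- The normalised exponentials. -/
noncomputable def expo (k : ℤ) : C(Torus, ℂ) := (nrm : ℂ) • fourier k

theorem orthonormal_expo :
    Orthonormal ℂ fun k : ℤ => ContinuousMap.toLp (E := ℂ) 2 (volume : Measure Torus) ℂ (expo k) := by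
  have h := orthonormal_iff_ite.1 (orthonormal_fourier (T := 2 * Real.pi))
  rw [orthonormal_iff_ite]
  intro i j
  have hij := h i j
  rw [fourierLp, fourierLp, ContinuousMap.inner_toLp, AddCircle.integral_haarAddCircle] at hij
  rw [ContinuousMap.inner_toLp]
  have e : (fun x => expo j x * conj (expo i x))
      = fun x => (nrm * nrm : ℂ) * (fourier j x * conj (fourier i x)) := by
    funext x
    simp only [expo, ContinuousMap.smul_apply, smul_eq_mul, map_mul, Complex.conj_ofReal]
    ring
  rw [e, integral_const_mul]
  have h2 : (∫ x : Torus, fourier j x * conj (fourier i x)) = (2 * Real.pi : ℝ) • (if i = j then (1 : ℂ) else 0) := by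
    rw [← hij, smul_inv_smul₀ Real.two_pi_pos.ne']
  rw [h2]
  split_ifs
  · rw [Complex.real_smul, mul_one]
    exact_mod_cast nrm_sq_mul
  · simp

/-- The Fourier basis of `L²(𝕋; ℂ)` for the Lebesgue measure. -/
noncomputable def expoBasis : HilbertBasis ℤ ℂ (Lp ℂ 2 (volume : Measure Torus)) :=
  HilbertBasis.mk orthonormal_expo (by
    rw [← span_fourier_toLp_closure_eq_top]
    refine Submodule.topologicalClosure_mono (Submodule.span_le.2 ?_)
    rintro _ ⟨k, rfl⟩
    have h : ContinuousMap.toLp (E := ℂ) 2 (volume : Measure Torus) ℂ (fourier k)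
        = (nrm : ℂ)⁻¹ • ContinuousMap.toLp (E := ℂ) 2 (volume : Measure Torus) ℂ (expo k) := by
      rw [expo, map_smul, inv_smul_smul₀]
      exact_mod_cast nrm_pos.ne'
    simp only [h]
    exact Submodule.smul_mem _ _ (Submodule.subset_span ⟨k, rfl⟩))

theorem expoBasis_apply (k : ℤ) :
    expoBasis k = ContinuousMap.toLp (E := ℂ) 2 (volume : Measure Torus) ℂ (expo k) := by
  simp [expoBasis]

end FourierBasis

/-! ### `L²(𝕋; ℝ²)` as a space of complex functions; multiplication and conjugation operators -/

section Complexification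

/-- The identification of `ℂ` with `ℝ²`. -/
noncomputable def toVec : ℂ ≃ₗᵢ[ℝ] Vec := Complex.orthonormalBasisOneI.repr

theorem toVec_apply (z : ℂ) : toVec z = !₂[z.re, z.im] := by
  ext i
  rw [toVec, Complex.orthonormalBasisOneI_repr_apply]

theorem inner_toVec (z w : ℂ) : inner ℝ (toVec z) (toVec w) = (conj z * w).re := by
  rw [LinearIsometryEquiv.inner_map_map, Complex.inner, mul_comm]

/-- The identification of `L²(𝕋; ℂ)` with `L²(𝕋; ℝ²)`. -/
noncomputable def vecLp : Lp ℂ 2 (volume : Measure Torus) ≃ₗᵢ[ℝ] L2 where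
  toFun u := toVec.toContinuousLinearEquiv.toContinuousLinearMap.compLp u
  invFun u := toVec.symm.toContinuousLinearEquiv.toContinuousLinearMap.compLp u
  map_add' u v := (toVec.toContinuousLinearEquiv.toContinuousLinearMap.compLpₗ 2 volume).map_add u v
  map_smul' c u := (toVec.toContinuousLinearEquiv.toContinuousLinearMap.compLpₗ 2 volume).map_smul c u
  left_inv u := by
    refine Lp.ext ?_
    filter_upwards [ContinuousLinearMap.coeFn_compLp
      toVec.symm.toContinuousLinearEquiv.toContinuousLinearMap
      (toVec.toContinuousLinearEquiv.toContinuousLinearMap.compLp u),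
      ContinuousLinearMap.coeFn_compLp toVec.toContinuousLinearEquiv.toContinuousLinearMap u]
      with x h1 h2
    rw [h1, h2]
    exact toVec.symm_apply_apply _
  right_inv u := by
    refine Lp.ext ?_
    filter_upwards [ContinuousLinearMap.coeFn_compLp
      toVec.toContinuousLinearEquiv.toContinuousLinearMap
      (toVec.symm.toContinuousLinearEquiv.toContinuousLinearMap.compLp u),
      ContinuousLinearMap.coeFn_compLp toVec.symm.toContinuousLinearEquiv.toContinuousLinearMap u]
      with x h1 h2
    rw [h1, h2]
    exact toVec.apply_symm_apply _
  norm_map' u := by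
    rw [Lp.norm_def, Lp.norm_def]
    congr 1
    refine eLpNorm_congr_norm_ae ?_
    filter_upwards [ContinuousLinearMap.coeFn_compLp
      toVec.toContinuousLinearEquiv.toContinuousLinearMap u] with x h1
    change ‖(toVec.toContinuousLinearEquiv.toContinuousLinearMap.compLp u) x‖ = _
    rw [h1]
    exact toVec.norm_map _

/-- The Fourier coefficients of an element of `L²(𝕋; ℝ²)`, viewed as a complex function. -/
noncomputable def coeffs : L2 ≃ₗᵢ[ℝ] SeqL2 :=
  vecLp.symm.trans
    { toFun := expoBasis.repr
      invFun := expoBasis.repr.symm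
      map_add' := map_add _
      map_smul' := fun r u => by
        have := expoBasis.repr.map_smul (r : ℂ) u
        simp only [RingHom.id_apply]
        exact this
      left_inv := expoBasis.repr.left_inv
      right_inv := expoBasis.repr.right_inv
      norm_map' := expoBasis.repr.norm_map }

/-- The element of `L²(𝕋; ℝ²)` given by a continuous complex function. -/
noncomputable def ofCont : C(Torus, ℂ) →L[ℝ] L2 :=
  (ContinuousMap.toLp (E := Vec) 2 (volume : Measure Torus) ℝ).comp
    (toVec.toContinuousLinearEquiv.toContinuousLinearMap.compLeftContinuous ℝ Torus)

theorem coeFn_ofCont (f : C(Torus, ℂ)) : ofCont f =ᵐ[volume] fun x => toVec (f x) :=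
  ContinuousMap.coeFn_toLp (𝕜 := ℝ) (volume : Measure Torus)
    (toVec.toContinuousLinearEquiv.toContinuousLinearMap.compLeftContinuous ℝ Torus f)

theorem inner_ofCont (u : L2) (f : C(Torus, ℂ)) :
    inner ℝ u (ofCont f) = ∫ x, inner ℝ (u x) (toVec (f x)) := by
  rw [L2.inner_def]
  refine integral_congr_ae ?_
  filter_upwards [coeFn_ofCont f] with x hx
  rw [hx]

theorem mode_coeffs (k : ℤ) (ζ : ℂ) : mode coeffs k ζ = ofCont (ζ • expo k) := by
  rw [mode_def, LinearIsometryEquiv.symm_apply_eq]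
  have h1 : vecLp (ContinuousMap.toLp (E := ℂ) 2 (volume : Measure Torus) ℂ (ζ • expo k))
      = ofCont (ζ • expo k) := by
    refine Lp.ext ?_
    filter_upwards [coeFn_ofCont (ζ • expo k), ContinuousLinearMap.coeFn_compLp
      toVec.toContinuousLinearEquiv.toContinuousLinearMap
        (ContinuousMap.toLp (E := ℂ) 2 (volume : Measure Torus) ℂ (ζ • expo k)),
      ContinuousMap.coeFn_toLp (p := 2) (𝕜 := ℂ) (volume : Measure Torus) (ζ • expo k)] with x h1 h2 h3
    rw [h1]
    refine h2.trans ?_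
    rw [h3]
    rfl
  rw [← h1]
  change _ = expoBasis.repr (vecLp.symm (vecLp _))
  rw [LinearIsometryEquiv.symm_apply_apply, map_smul, map_smul, ← expoBasis_apply,
    HilbertBasis.repr_self, ← lp.single_smul]
  simp

/-- Complex multiplication transported to `ℝ²`. -/
noncomputable def mulVecC : ℂ →L[ℝ] Vec →L[ℝ] Vec :=
  ((ContinuousLinearMap.compL ℝ Vec ℂ Vec toVec.toContinuousLinearEquiv.toContinuousLinearMap).comp
    ((ContinuousLinearMap.compL ℝ Vec ℂ ℂ).flip
      toVec.symm.toContinuousLinearEquiv.toContinuousLinearMap)).comp (ContinuousLinearMap.mul ℝ ℂ)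

theorem mulVecC_apply (z : ℂ) (v : Vec) : mulVecC z v = toVec (z * toVec.symm v) := rfl

/-- Multiplication by a continuous complex function on `L²(𝕋; ℝ²)`. -/
noncomputable def mulOp : C(Torus, ℂ) →L[ℝ] L2 →L[ℝ] L2 :=
  (mulVecC.holderL (volume : Measure Torus) ∞ 2 2).comp
    (ContinuousMap.toLp (E := ℂ) ∞ (volume : Measure Torus) ℝ)

theorem mulOp_ofCont (f g : C(Torus, ℂ)) : mulOp f (ofCont g) = ofCont (f * g) := by
  refine Lp.ext ?_
  filter_upwards [coeFn_ofCont (f * g), coeFn_ofCont g,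
    ContinuousMap.coeFn_toLp (p := ∞) (𝕜 := ℝ) (volume : Measure Torus) f,
    mulVecC.coeFn_holder (r := 2) (ContinuousMap.toLp (E := ℂ) ∞ (volume : Measure Torus) ℝ f) (ofCont g)]
    with x h1 h2 h3 h4
  rw [h1]
  refine h4.trans ?_
  rw [h3, h2, mulVecC_apply, LinearIsometryEquiv.symm_apply_apply]
  rfl

/-- Pointwise complex conjugation on `L²(𝕋; ℝ²)`. -/
noncomputable def conjOp : L2 →L[ℝ] L2 :=
  ((toVec.toContinuousLinearEquiv.toContinuousLinearMap.comp
    Complex.conjCLE.toContinuousLinearMap).comp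
    toVec.symm.toContinuousLinearEquiv.toContinuousLinearMap).compLpL 2 volume

theorem conjOp_ofCont (g : C(Torus, ℂ)) : conjOp (ofCont g) = ofCont (star g) := by
  refine Lp.ext ?_
  filter_upwards [coeFn_ofCont (star g), coeFn_ofCont g,
    ContinuousLinearMap.coeFn_compLp ((toVec.toContinuousLinearEquiv.toContinuousLinearMap.comp
      Complex.conjCLE.toContinuousLinearMap).comp
      toVec.symm.toContinuousLinearEquiv.toContinuousLinearMap) (ofCont g)] with x h1 h2 h3
  rw [h1]
  refine h3.trans ?_
  rw [h2]
  simp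

end Complexification

end DispersiveTorus

namespace DispersiveTorus

open scoped ComplexConjugate

/-! ### The differential algebra `C^∞(𝕋; ℂ)` -/

section SmoothFunctions

theorem dx_coe {F : Type*} [NormedAddCommGroup F] [NormedSpace ℝ F] (k : ℕ) (f : Torus → F) (y : ℝ) :
    dx k f (y : Torus) = iteratedDeriv k (fun z : ℝ => f (z : Torus)) y := by
  have h := congrFun (iteratedDeriv_comp_const_add k (fun z : ℝ => f (z : Torus)) y) 0
  simp only [add_zero] at h
  rw [← h]
  rfl

theorem continuous_of_lift {F : Type*} [TopologicalSpace F] {f : Torus → F}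
    (h : Continuous fun y : ℝ => f (y : Torus)) : Continuous f :=
  (QuotientAddGroup.isQuotientMap_mk (N := AddSubgroup.zmultiples (2 * Real.pi))).continuous_iff.2 h

/-- The algebra `C^∞(𝕋; ℂ)`. -/
noncomputable def Smooth : Subalgebra ℂ C(Torus, ℂ) where
  carrier := {f | IsSmooth f}
  mul_mem' {f g} hf hg := by
    have hf' : ContDiff ℝ ∞ fun y : ℝ => f (y : Torus) := hf
    have hg' : ContDiff ℝ ∞ fun y : ℝ => g (y : Torus) := hg
    exact hf'.mul hg'
  add_mem' {f g} hf hg := by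
    have hf' : ContDiff ℝ ∞ fun y : ℝ => f (y : Torus) := hf
    have hg' : ContDiff ℝ ∞ fun y : ℝ => g (y : Torus) := hg
    exact hf'.add hg'
  algebraMap_mem' z := by
    have h : ContDiff ℝ ∞ fun _ : ℝ => z := contDiff_const
    exact h

noncomputable instance : CoeFun Smooth fun _ => Torus → ℂ := ⟨fun f => f.1⟩

theorem contDiff_lift (f : Smooth) : ContDiff ℝ ∞ fun y : ℝ => f (y : Torus) := f.2

theorem smooth_ext {f g : Smooth} (h : ∀ y : ℝ, f (y : Torus) = g (y : Torus)) : f = g :=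
  Subtype.ext (ContinuousMap.ext fun x => QuotientAddGroup.induction_on x h)

/-- A smooth function from its smooth lift. -/
noncomputable def smoothOfLift (f : Torus → ℂ) (hf : ContDiff ℝ ∞ fun y : ℝ => f (y : Torus)) :
    Smooth := ⟨⟨f, continuous_of_lift hf.continuous⟩, hf⟩

theorem dx_one_coe (f : Torus → ℂ) (y : ℝ) :
    dx 1 f (y : Torus) = deriv (fun z : ℝ => f (z : Torus)) y := by
  rw [dx_coe, iteratedDeriv_one]

theorem contDiff_dx (f : Smooth) : ContDiff ℝ ∞ fun y : ℝ => dx 1 f (y : Torus) := by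
  simp only [dx_one_coe]
  exact (contDiff_infty_iff_deriv.1 (contDiff_lift f)).2

theorem hasDerivAt_dx (f : Smooth) (y : ℝ) :
    HasDerivAt (fun y : ℝ => f (y : Torus)) (dx 1 f (y : Torus)) y := by
  rw [dx_one_coe]
  exact ((contDiff_lift f).differentiable (by simp)).differentiableAt.hasDerivAt

/-- The derivation `∂ₓ` of `C^∞(𝕋; ℂ)`. -/
noncomputable def D : Derivation ℂ Smooth Smooth :=
  Derivation.mk'
    { toFun := fun f => smoothOfLift (dx 1 f) (contDiff_dx f)
      map_add' := fun f g => smooth_ext fun y => by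
        change dx 1 (f + g : Smooth) (y : Torus) = dx 1 f y + dx 1 g y
        rw [dx_one_coe]
        exact ((hasDerivAt_dx f y).add (hasDerivAt_dx g y)).deriv
      map_smul' := fun c f => smooth_ext fun y => by
        change dx 1 (c • f : Smooth) (y : Torus) = c * dx 1 f y
        rw [dx_one_coe]
        exact ((hasDerivAt_dx f y).const_mul c).deriv }
    (fun f g => smooth_ext fun y => by
      change dx 1 (f * g : Smooth) (y : Torus) = f y * dx 1 g y + g y * dx 1 f y
      rw [dx_one_coe]
      refine ((hasDerivAt_dx f y).mul (hasDerivAt_dx g y)).deriv.trans ?_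
      ring)

theorem hasDerivAt_lift (f : Smooth) (y : ℝ) :
    HasDerivAt (fun y : ℝ => f (y : Torus)) (D f (y : Torus)) y := hasDerivAt_dx f y

theorem D_eq_of_hasDerivAt {f g : Smooth}
    (h : ∀ y : ℝ, HasDerivAt (fun y : ℝ => f (y : Torus)) (g (y : Torus)) y) : D f = g :=
  smooth_ext fun y => (hasDerivAt_lift f y).unique (h y)

theorem D_mul (f g : Smooth) : D (f * g) = f * D g + D f * g := by
  rw [Derivation.leibniz, smul_eq_mul, smul_eq_mul, mul_comm g]

theorem dx_eq_iterate (k : ℕ) (f : Smooth) (x : Torus) : dx k f x = (D^[k] f) x := by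
  induction k generalizing f with
  | zero =>
    refine QuotientAddGroup.induction_on x fun y => ?_
    exact (dx_coe 0 f y).trans (by rw [iteratedDeriv_zero]; rfl)
  | succ k ih =>
    rw [Function.iterate_succ_apply, ← ih]
    refine QuotientAddGroup.induction_on x fun y => ?_
    refine (dx_coe (k + 1) f y).trans (Eq.trans ?_ (dx_coe k (D f) y).symm)
    rw [iteratedDeriv_succ']
    congr 1
    funext z
    exact (hasDerivAt_lift f z).deriv

/-- Complex conjugation on `C^∞(𝕋; ℂ)`. -/
noncomputable def cj : Smooth →+* Smooth where
  toFun f := ⟨star f.1, Complex.conjCLE.contDiff.comp (contDiff_lift f)⟩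
  map_one' := smooth_ext fun _ => map_one conj
  map_mul' f g := smooth_ext fun y => map_mul conj (f y) (g y)
  map_zero' := smooth_ext fun _ => map_zero conj
  map_add' f g := smooth_ext fun y => map_add conj (f y) (g y)

theorem cj_val (f : Smooth) : (cj f).1 = star f.1 := rfl

theorem cj_cj (f : Smooth) : cj (cj f) = f := smooth_ext fun y => Complex.conj_conj (f y)

theorem D_cj (f : Smooth) : D (cj f) = cj (D f) :=
  D_eq_of_hasDerivAt fun y =>
    Complex.conjCLE.toContinuousLinearMap.hasFDerivAt.comp_hasDerivAt y (hasDerivAt_lift f y)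

/-- Constant functions. -/
noncomputable def cst : ℂ →+* Smooth := algebraMap ℂ Smooth

theorem D_cst (z : ℂ) : D (cst z) = 0 := D.map_algebraMap z

theorem cj_cst (z : ℂ) : cj (cst z) = cst (conj z) := rfl

/-- The normalised exponentials as smooth functions. -/
noncomputable def ex (k : ℤ) : Smooth :=
  ⟨expo k, by
    have : (fun y : ℝ => expo k (y : Torus)) = fun y : ℝ => (nrm : ℂ) * Complex.exp (Complex.I * k * y) := by
      funext y
      have h := fourier_coe_apply (T := 2 * Real.pi) (n := k) (x := y)
      change (nrm : ℂ) * fourier k (y : Torus) = _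
      rw [h]
      congr 2
      have : (Real.pi : ℂ) ≠ 0 := by exact_mod_cast Real.pi_ne_zero
      push_cast
      field_simp
    change ContDiff ℝ ∞ fun y : ℝ => expo k (y : Torus)
    rw [this]
    exact contDiff_const.mul ((contDiff_const.mul Complex.ofRealCLM.contDiff).cexp)⟩

theorem D_ex (k : ℤ) : D (ex k) = cst (Complex.I * k) * ex k :=
  D_eq_of_hasDerivAt fun y => by
    have h := (hasDerivAt_fourier (2 * Real.pi) k y).const_mul (nrm : ℂ)
    refine h.of_eq (fun t => rfl) ?_
    change Complex.I * k * ((nrm : ℂ) * fourier k (y : Torus)) = _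
    have : (Real.pi : ℂ) ≠ 0 := by exact_mod_cast Real.pi_ne_zero
    push_cast
    field_simp

theorem cj_ex (k : ℤ) : cj (ex k) = ex (-k) :=
  smooth_ext fun y => by
    change conj ((nrm : ℂ) * fourier k (y : Torus)) = (nrm : ℂ) * fourier (-k) (y : Torus)
    rw [map_mul, Complex.conj_ofReal, fourier_neg]

end SmoothFunctions

/-! ### Mean values and periodic primitives -/

section Primitive

/-- The mean value of a continuous function on the torus. -/
noncomputable def mean : C(Torus, ℂ) →L[ℂ] ℂ :=
  LinearMap.mkContinuous
    { toFun := fun f => (2 * Real.pi : ℂ)⁻¹ * ∫ y in (0 : ℝ)..2 * Real.pi, f (y : Torus)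
      map_add' := fun f g => by
        have hc : ∀ f : C(Torus, ℂ), Continuous fun y : ℝ => f (y : Torus) := fun f =>
          f.continuous.comp (AddCircle.continuous_mk' _)
        simp only [ContinuousMap.add_apply]
        rw [intervalIntegral.integral_add ((hc f).intervalIntegrable _ _)
          ((hc g).intervalIntegrable _ _), mul_add]
      map_smul' := fun c f => by
        simp only [ContinuousMap.smul_apply, smul_eq_mul, intervalIntegral.integral_const_mul,
          RingHom.id_apply]
        ring } 1 fun f => by
    have hpi := Real.pi_pos
    have h : ‖∫ y in (0 : ℝ)..2 * Real.pi, f (y : Torus)‖ ≤ ‖f‖ * |2 * Real.pi - 0| :=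
      intervalIntegral.norm_integral_le_of_norm_le_const fun y _ => f.norm_coe_le_norm _
    change ‖(2 * Real.pi : ℂ)⁻¹ * ∫ y in (0 : ℝ)..2 * Real.pi, f (y : Torus)‖ ≤ _
    rw [norm_mul, norm_inv, one_mul]
    have e : ‖(2 * Real.pi : ℂ)‖ = 2 * Real.pi := by
      simp [abs_of_pos hpi]
    rw [e]
    rw [sub_zero, abs_of_pos (by positivity)] at h
    calc (2 * Real.pi)⁻¹ * ‖∫ y in (0 : ℝ)..2 * Real.pi, f (y : Torus)‖
        ≤ (2 * Real.pi)⁻¹ * (‖f‖ * (2 * Real.pi)) := by gcongr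
      _ = ‖f‖ := by field_simp

theorem mean_apply (f : C(Torus, ℂ)) :
    mean f = (2 * Real.pi : ℂ)⁻¹ * ∫ y in (0 : ℝ)..2 * Real.pi, f (y : Torus) := rfl

theorem continuous_lift (f : C(Torus, ℂ)) : Continuous fun y : ℝ => f (y : Torus) :=
  f.continuous.comp (AddCircle.continuous_mk' _)

theorem norm_mean_le (f : C(Torus, ℂ)) : ‖mean f‖ ≤ ‖f‖ := by
  simpa using mean.le_of_opNorm_le (LinearMap.mkContinuous_norm_le _ zero_le_one _) f

/-- Subtracting the mean makes the integral over a period vanish; this is the only obstruction to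
solving the transport equations on the circle. -/
theorem periodic_primitive (f : C(Torus, ℂ)) :
    Function.Periodic (fun y : ℝ => ∫ s in (0 : ℝ)..y, (f (s : Torus) - mean f)) (2 * Real.pi) := by
  intro y
  have hc : Continuous fun s : ℝ => f (s : Torus) - mean f := (continuous_lift f).sub continuous_const
  have hper : Function.Periodic (fun s : ℝ => f (s : Torus) - mean f) (2 * Real.pi) := fun s => by
    simp only [AddCircle.coe_add_period]
  have h0 : ∫ s in (0 : ℝ)..0 + 2 * Real.pi, (f (s : Torus) - mean f) = 0 := by
    rw [intervalIntegral.integral_sub ((continuous_lift f).intervalIntegrable _ _)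
      (continuous_const.intervalIntegrable _ _), intervalIntegral.integral_const, mean_apply,
      zero_add, sub_zero, Complex.real_smul]
    have : (Real.pi : ℂ) ≠ 0 := by exact_mod_cast Real.pi_ne_zero
    push_cast
    field_simp
    ring
  simp only
  rw [← intervalIntegral.integral_add_adjacent_intervals (hc.intervalIntegrable 0 y)
    (hc.intervalIntegrable y _), hper.intervalIntegral_add_eq y 0, h0, add_zero]

/-- The primitive, vanishing at `0`, of a continuous function minus its mean value. -/
noncomputable def prim : C(Torus, ℂ) →L[ℂ] C(Torus, ℂ) :=
  LinearMap.mkContinuous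
    { toFun := fun f => ⟨(periodic_primitive f).lift, continuous_of_lift (by
          simp only [Function.Periodic.lift_coe]
          exact intervalIntegral.continuous_primitive (fun a b =>
            ((continuous_lift f).sub continuous_const).intervalIntegrable a b) 0)⟩
      map_add' := fun f g => ContinuousMap.ext fun x => QuotientAddGroup.induction_on x fun y => by
        change ∫ s in (0 : ℝ)..y, (f s + g s - mean (f + g)) = (∫ s in (0 : ℝ)..y, (f s - mean f))
          + ∫ s in (0 : ℝ)..y, (g s - mean g)
        have hc : ∀ f : C(Torus, ℂ), Continuous fun s : ℝ => f (s : Torus) - mean f := fun f =>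
          (continuous_lift f).sub continuous_const
        rw [← intervalIntegral.integral_add ((hc f).intervalIntegrable _ _)
          ((hc g).intervalIntegrable _ _)]
        congr 1
        funext s
        rw [map_add]
        ring
      map_smul' := fun c f => ContinuousMap.ext fun x => QuotientAddGroup.induction_on x fun y => by
        change ∫ s in (0 : ℝ)..y, (c * f s - mean (c • f)) = c * ∫ s in (0 : ℝ)..y, (f s - mean f)
        rw [← intervalIntegral.integral_const_mul]
        congr 1
        funext s
        rw [map_smul, smul_eq_mul]
        ring } (4 * Real.pi) fun f => by
    have hpi := Real.pi_pos
    refine (ContinuousMap.norm_le _ (by positivity)).2 fun x => ?_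
    obtain ⟨y, hy, rfl⟩ : ∃ y ∈ Set.Ico (0 : ℝ) (0 + 2 * Real.pi), (y : Torus) = x := by
      have : x ∈ ((↑) : ℝ → Torus) '' Set.Ico (0 : ℝ) (0 + 2 * Real.pi) := by
        rw [AddCircle.coe_image_Ico_eq]
        trivial
      exact this
    change ‖∫ s in (0 : ℝ)..y, (f s - mean f)‖ ≤ _
    have h : ‖∫ s in (0 : ℝ)..y, (f (s : Torus) - mean f)‖ ≤ (2 * ‖f‖) * |y - 0| :=
      intervalIntegral.norm_integral_le_of_norm_le_const fun s _ => by
        refine (norm_sub_le _ _).trans ?_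
        linarith [f.norm_coe_le_norm (s : Torus), norm_mean_le f]
    rw [sub_zero, abs_of_nonneg hy.1] at h
    have hy2 : y ≤ 2 * Real.pi := by linarith [hy.2]
    calc _ ≤ (2 * ‖f‖) * y := h
      _ ≤ (2 * ‖f‖) * (2 * Real.pi) := by gcongr
      _ = _ := by ring

theorem prim_coe (f : C(Torus, ℂ)) (y : ℝ) :
    prim f (y : Torus) = ∫ s in (0 : ℝ)..y, (f (s : Torus) - mean f) := rfl

theorem hasDerivAt_prim (f : C(Torus, ℂ)) (y : ℝ) :
    HasDerivAt (fun y : ℝ => prim f (y : Torus)) (f (y : Torus) - mean f) y := by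
  simp only [prim_coe]
  have hc : Continuous fun s : ℝ => f (s : Torus) - mean f := (continuous_lift f).sub continuous_const
  exact intervalIntegral.integral_hasDerivAt_right (hc.intervalIntegrable _ _)
    hc.stronglyMeasurable.stronglyMeasurableAtFilter hc.continuousAt

/-- The primitive of a smooth function. -/
noncomputable def sprim (f : Smooth) : Smooth :=
  ⟨prim f.1, by
    change ContDiff ℝ ∞ fun y : ℝ => prim f.1 (y : Torus)
    refine contDiff_infty_iff_deriv.2 ⟨fun y => (hasDerivAt_prim f.1 y).differentiableAt, ?_⟩
    have : deriv (fun y : ℝ => prim f.1 (y : Torus)) = fun y : ℝ => f (y : Torus) - mean f.1 :=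
      funext fun y => (hasDerivAt_prim f.1 y).deriv
    rw [this]
    exact (contDiff_lift f).sub contDiff_const⟩

theorem D_sprim (f : Smooth) : D (sprim f) = f - cst (mean f.1) :=
  D_eq_of_hasDerivAt fun y => hasDerivAt_prim f.1 y

end Primitive

/-! ### Stability of bounded `C¹` curves of smooth functions -/

section RegularCurves

/-- Bounded `C¹` curves in `C^∞(𝕋; ℂ)`. -/
def Reg (a : ℝ → Smooth) : Prop :=
  ∀ n : ℕ, (∃ C : ℝ, ∀ t, ‖(D^[n] (a t)).1‖ ≤ C) ∧
    ∃ a' : ℝ → C(Torus, ℂ), Continuous a' ∧ ∀ t, HasDerivAt (fun t => (D^[n] (a t)).1) (a' t) t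

theorem Reg.continuous {a : ℝ → Smooth} (ha : Reg a) : Continuous fun t => (a t).1 := by
  obtain ⟨-, a', -, h⟩ := ha 0
  exact continuous_iff_continuousAt.2 fun t => (h t).continuousAt

theorem Reg.D {a : ℝ → Smooth} (ha : Reg a) : Reg fun t => D (a t) := fun n => ha (n + 1)

theorem iterate_D_add (n : ℕ) (f g : Smooth) :
    DispersiveTorus.D^[n] (f + g) = DispersiveTorus.D^[n] f + DispersiveTorus.D^[n] g :=
  iterate_map_add DispersiveTorus.D n f g

theorem Reg.add {a b : ℝ → Smooth} (ha : Reg a) (hb : Reg b) : Reg fun t => a t + b t := by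
  intro n
  obtain ⟨⟨C₁, h₁⟩, a', ha', hda⟩ := ha n
  obtain ⟨⟨C₂, h₂⟩, b', hb', hdb⟩ := hb n
  simp only [iterate_D_add]
  exact ⟨⟨C₁ + C₂, fun t => (norm_add_le _ _).trans (add_le_add (h₁ t) (h₂ t))⟩,
    fun t => a' t + b' t, ha'.add hb', fun t => (hda t).add (hdb t)⟩

/-- Induction on the number of derivatives with both factors free: one use of the Leibniz rule
lowers the order, and no binomial expansion is needed. -/
theorem Reg.mul {a b : ℝ → Smooth} (ha : Reg a) (hb : Reg b) : Reg fun t => a t * b t := by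
  intro n
  induction n generalizing a b with
  | zero =>
    obtain ⟨⟨C₁, h₁⟩, a', ha', hda⟩ := ha 0
    obtain ⟨⟨C₂, h₂⟩, b', hb', hdb⟩ := hb 0
    refine ⟨⟨C₁ * C₂, fun t => (norm_mul_le _ _).trans (mul_le_mul (h₁ t) (h₂ t) (norm_nonneg _)
      ((norm_nonneg _).trans (h₁ t)))⟩, fun t => a' t * (b t).1 + (a t).1 * b' t,
      (ha'.mul hb.continuous).add (ha.continuous.mul hb'), fun t => (hda t).mul (hdb t)⟩
  | succ n ih =>
    obtain ⟨⟨C₁, h₁⟩, a', ha', hda⟩ := ih ha hb.D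
    obtain ⟨⟨C₂, h₂⟩, b', hb', hdb⟩ := ih ha.D hb
    simp only [Function.iterate_succ_apply, D_mul, iterate_D_add]
    exact ⟨⟨C₁ + C₂, fun t => (norm_add_le _ _).trans (add_le_add (h₁ t) (h₂ t))⟩,
      fun t => a' t + b' t, ha'.add hb', fun t => (hda t).add (hdb t)⟩

theorem Reg.cj {a : ℝ → Smooth} (ha : Reg a) : Reg fun t => cj (a t) := by
  intro n
  have e : ∀ (n : ℕ) (f : Smooth), DispersiveTorus.D^[n] (DispersiveTorus.cj f)
      = DispersiveTorus.cj (DispersiveTorus.D^[n] f) := by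
    intro n
    induction n with
    | zero => exact fun f => rfl
    | succ n ih => exact fun f => by rw [Function.iterate_succ_apply, D_cj, ih]; rfl
  obtain ⟨⟨C, h⟩, a', ha', hda⟩ := ha n
  simp only [e, cj_val]
  refine ⟨⟨C, fun t => by rw [norm_star]; exact h t⟩, fun t => star (a' t), ha'.star, fun t => ?_⟩
  exact (hda t).star

theorem reg_const (f : Smooth) : Reg fun _ => f := fun _ =>
  ⟨⟨_, fun _ => le_rfl⟩, fun _ => 0, continuous_const, fun _ => hasDerivAt_const _ _⟩

theorem Reg.neg {a : ℝ → Smooth} (ha : Reg a) : Reg fun t => -a t := by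
  have e : ∀ t, -a t = (-1) * a t := fun t => by ring
  simpa only [e] using (reg_const (-1)).mul ha

theorem Reg.sub {a b : ℝ → Smooth} (ha : Reg a) (hb : Reg b) : Reg fun t => a t - b t := by
  simpa [sub_eq_add_neg] using ha.add hb.neg

theorem Reg.mean {a : ℝ → Smooth} (ha : Reg a) : Reg fun t => cst (mean (a t).1) := by
  intro n
  cases n with
  | zero =>
    obtain ⟨⟨C, h⟩, a', ha', hda⟩ := ha 0
    have hL : ∀ t, (cst (DispersiveTorus.mean (a t).1)).1
        = (Algebra.linearMap ℂ C(Torus, ℂ)) (DispersiveTorus.mean (a t).1) := fun t => rfl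
    set L : ℂ →L[ℂ] C(Torus, ℂ) := (Algebra.linearMap ℂ C(Torus, ℂ)).toContinuousLinearMap with hLdef
    have hc : ∀ f, ‖L f‖ ≤ ‖f‖ := fun z =>
      (ContinuousMap.norm_le _ (norm_nonneg _)).2 fun x => le_rfl
    refine ⟨⟨C, fun t => (hc _).trans ((norm_mean_le _).trans (h t))⟩,
      fun t => L (DispersiveTorus.mean (a' t)), ?_, fun t => ?_⟩
    · exact L.continuous.comp (DispersiveTorus.mean.continuous.comp ha')
    · exact ((L.comp DispersiveTorus.mean).restrictScalars ℝ).hasFDerivAt.comp_hasDerivAt t (hda t)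
  | succ n =>
    simp only [Function.iterate_succ_apply, D_cst]
    exact reg_const 0 n

theorem Reg.sprim {a : ℝ → Smooth} (ha : Reg a) : Reg fun t => sprim (a t) := by
  intro n
  cases n with
  | zero =>
    obtain ⟨⟨C, h⟩, a', ha', hda⟩ := ha 0
    refine ⟨⟨‖prim‖ * C, fun t => (prim.le_opNorm _).trans (by gcongr; exact h t)⟩,
      fun t => prim (a' t), prim.continuous.comp ha', fun t => ?_⟩
    exact (prim.restrictScalars ℝ).hasFDerivAt.comp_hasDerivAt t (hda t)
  | succ n =>
    simp only [Function.iterate_succ_apply, D_sprim]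
    exact (ha.sub ha.mean) n

end RegularCurves

/-! ### Symbolic computation of the conjugated operator -/

section SymbolCalculus

/-- The real-linear differential operator
`-i ∂⁴ + p₂ ∂² + q₂ ∂² C + p₁ ∂ + q₁ ∂ C + p₀ + q₀ C`, with `C` the complex conjugation. -/
noncomputable def diffOp (p₂ q₂ p₁ q₁ p₀ q₀ f : Smooth) : Smooth :=
  -(cst Complex.I * D (D (D (D f)))) + p₂ * D (D f) + q₂ * D (D (cj f)) + p₁ * D f + q₁ * D (cj f)
    + p₀ * f + q₀ * cj f

/-- The coefficient of the direct mode in the remainder. -/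
noncomputable def remDirect (p₂ q₂ p₁ q₁ p₀ q₀ a₁ a₂ c₂ c₃ n₂ n₁ i s τ w₁ w₂ : Smooth) : Smooth :=
  p₀ * 1 + (p₂ - n₂) * w₂ + (p₁ - n₁) * (w₁ * (1 + τ))
    + (-(6 * i * D (D a₁)) + (p₂ - n₂) * a₁) * (w₁ * τ)
    + (-(i * D (D (D (D a₁)))) + p₂ * D (D a₁) + p₁ * D a₁ + p₀ * a₁) * s
    + (-(4 * i * D (D (D a₁))) + 2 * p₂ * D a₁ + (p₁ - n₁) * a₁) * τ
    + (-(i * D (D (D (D a₂)))) + p₂ * D (D a₂) + p₁ * D a₂ + p₀ * a₂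
        + q₂ * D (D (cj c₂)) + q₁ * D (cj c₂) + q₀ * cj c₂) * (s * s)
    + (-(4 * i * D (D (D a₂))) + 2 * p₂ * D a₂ + (p₁ - n₁) * a₂
        + 2 * q₂ * D (cj c₂) + q₁ * cj c₂) * (τ * s)
    + (-(6 * i * D (D a₂)) + (p₂ - n₂) * a₂ + q₂ * cj c₂) * (τ * τ)
    + (q₂ * D (D (cj c₃)) + q₁ * D (cj c₃) + q₀ * cj c₃) * (s * s * s)
    + (2 * q₂ * D (cj c₃) + q₁ * cj c₃) * (τ * s * s)
    + (q₂ * cj c₃) * (τ * τ * s)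

/-- The coefficient of the conjugate mode in the remainder. -/
noncomputable def remConj (p₂ q₂ p₁ q₁ p₀ q₀ a₁ a₂ c₂ c₃ n₂ n₁ i s τ w₁ w₂ : Smooth) : Smooth :=
  q₀ * 1 + q₂ * (w₂ * (1 + τ)) + (-q₁) * (w₁ * (1 + τ + τ * τ))
    + (-(q₂ * cj a₁)) * (w₁ * τ * (1 + τ)) + (4 * i * D c₂) * (w₁ * τ * τ)
    + (-(q₂ * D (D (cj a₁)) + q₁ * D (cj a₁) + q₀ * cj a₁)) * s
    + (2 * q₂ * D (cj a₁) + q₁ * cj a₁) * τ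
    + (q₂ * D (D (cj a₂)) + q₁ * D (cj a₂) + q₀ * cj a₂
        - i * D (D (D (D c₂))) + p₂ * D (D c₂) + p₁ * D c₂ + p₀ * c₂) * (s * s)
    + (4 * i * D (D (D c₂)) - 2 * p₂ * D c₂ - (p₁ - n₁) * c₂
        - (2 * q₂ * D (cj a₂) + q₁ * cj a₂)) * (τ * s)
    + (q₂ * cj a₂ - 6 * i * D (D c₂) + (p₂ + n₂) * c₂) * (τ * τ)
    + (i * D (D (D (D c₃))) - p₂ * D (D c₃) - p₁ * D c₃ - p₀ * c₃) * (s * s * s)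
    + (2 * p₂ * D c₃ + (p₁ - n₁) * c₃ - 4 * i * D (D (D c₃))) * (τ * s * s)
    + (6 * i * D (D c₃) - (p₂ + n₂) * c₃) * (τ * τ * s)
    + (-(4 * i * D c₃)) * (τ * τ * τ)

/-- On functions times an exponential, `∂` acts on the amplitude as `∂ + K`; the two lemmas that
follow expand the powers of `∂ + K` for constant `K`. -/
theorem D_mul_exp {e K : Smooth} (he : D e = K * e) (f : Smooth) : D (f * e) = (D f + K * f) * e := by
  rw [D_mul, he]
  ring

theorem D2_mul_exp {e K : Smooth} (he : D e = K * e) (hK : D K = 0) (f : Smooth) :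
    D (D (f * e)) = (D (D f) + 2 * K * D f + K * K * f) * e := by
  rw [D_mul_exp he, D_mul_exp he]
  simp only [map_add, D_mul, hK]
  ring

theorem D4_mul_exp {e K : Smooth} (he : D e = K * e) (hK : D K = 0) (f : Smooth) :
    D (D (D (D (f * e)))) = (D (D (D (D f))) + 4 * K * D (D (D f)) + 6 * K * K * D (D f)
      + 4 * K * K * K * D f + K * K * K * K * f) * e := by
  rw [D2_mul_exp he hK, D2_mul_exp he hK]
  have h2 : D (2 : Smooth) = 0 := by
    have h := D_cst 2
    rwa [map_ofNat] at h
  simp only [map_add, D_mul, hK, h2, map_zero]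
  ring

theorem D_mul_of_const {c : Smooth} (hc : D c = 0) (f : Smooth) : D (f * c) = D f * c := by
  rw [D_mul, hc]
  ring

/-- Conjugation of the differential operator to a diagonal one, modulo a bounded remainder. -/
theorem diffOp_conjugation {p₂ q₂ p₁ q₁ p₀ q₀ a₁ a₂ c₂ c₃ n₂ n₁ i K s τ w₁ w₂ z z' e e' : Smooth}
    (hi : i = cst Complex.I) (he : D e = K * e) (he' : cj e = e') (hz : cj z = z')
    (hDz : D z = 0) (hK : D K = 0) (hcK : cj K = -K) (hs : D s = 0) (hcs : cj s = -s)
    (hτ : τ = K * s) (hw₁ : w₁ = K * (1 - K * s)) (hw₂ : w₂ = K * K * (1 - K * s))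
    (h1 : -(4 * i * D a₁) + p₂ - n₂ = 0)
    (h2 : -(4 * i * D a₂) - 6 * i * D (D a₁) + (p₂ - n₂) * a₁ + p₁ - n₁ = 0)
    (h3 : -(2 * i * c₂) + q₂ = 0)
    (h4 : 2 * i * c₃ + 4 * i * D c₂ - q₂ * cj a₁ - q₁ = 0) :
    diffOp p₂ q₂ p₁ q₁ p₀ q₀
      ((1 + a₁ * s + a₂ * (s * s)) * z * e + (c₂ * (s * s) - c₃ * (s * s * s)) * z' * e')
    = (1 + a₁ * s + a₂ * (s * s)) * ((-(i * (K * K * K * K)) + n₂ * (K * K) + n₁ * K) * z) * e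
      - (c₂ * (s * s) - c₃ * (s * s * s))
        * ((-(i * (K * K * K * K)) + n₂ * (K * K) + n₁ * K) * z') * e'
      + remDirect p₂ q₂ p₁ q₁ p₀ q₀ a₁ a₂ c₂ c₃ n₂ n₁ i s τ w₁ w₂ * z * e
      + remConj p₂ q₂ p₁ q₁ p₀ q₀ a₁ a₂ c₂ c₃ n₂ n₁ i s τ w₁ w₂ * z' * e' := by
  have he2 : D e' = -K * e' := by rw [← he', D_cj, he, map_mul, hcK]
  have hcz : cj z' = z := by rw [← hz, cj_cj]
  have hce : cj e' = e := by rw [← he', cj_cj]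
  have hDz' : D z' = 0 := by rw [← hz, D_cj, hDz, map_zero]
  have hmK : D (-K) = 0 := by rw [map_neg, hK, neg_zero]
  have h1' : D (1 : Smooth) = 0 := D.map_one_eq_zero
  have hss : D (s * s) = 0 := by rw [D_mul, hs]; ring
  have hsss : D (s * s * s) = 0 := by rw [D_mul, hs, hss]; ring
  have hcj : cj ((1 + a₁ * s + a₂ * (s * s)) * z * e + (c₂ * (s * s) - c₃ * (s * s * s)) * z' * e')
      = (cj c₂ * (s * s) + cj c₃ * (s * s * s)) * z * e
        + (1 - cj a₁ * s + cj a₂ * (s * s)) * z' * e' := by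
    simp only [map_add, map_sub, map_mul, hcs, hz, hcz, hce, he', map_one]
    ring
  have hf1 : D (1 + a₁ * s + a₂ * (s * s)) = D a₁ * s + D a₂ * (s * s) := by
    rw [map_add, map_add, D_mul_of_const hs, D_mul_of_const hss, h1', zero_add]
  have hlin : ∀ f g : Smooth, D (f * s + g * (s * s)) = D f * s + D g * (s * s) := fun f g => by
    rw [map_add, D_mul_of_const hs, D_mul_of_const hss]
  have hlin2 : ∀ f g : Smooth, D (f * (s * s) - g * (s * s * s)) = D f * (s * s) - D g * (s * s * s) :=
    fun f g => by rw [map_sub, D_mul_of_const hss, D_mul_of_const hsss]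
  have hlin3 : ∀ f g : Smooth, D (f * (s * s) + g * (s * s * s)) = D f * (s * s) + D g * (s * s * s) :=
    fun f g => by rw [map_add, D_mul_of_const hss, D_mul_of_const hsss]
  have hf2 : D (1 - cj a₁ * s + cj a₂ * (s * s)) = D (-cj a₁) * s + D (cj a₂) * (s * s) := by
    rw [map_add, map_sub, D_mul_of_const hs, D_mul_of_const hss, h1', map_neg]
    ring
  rw [diffOp, hcj]
  have hs1 : ∀ f g : Smooth, D (f * e + g * e') = (D f + K * f) * e + (D g + -K * g) * e' :=
    fun f g => by rw [map_add, D_mul_exp he, D_mul_exp he2]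
  have hs2 : ∀ f g : Smooth, D (D (f * e + g * e')) = (D (D f) + 2 * K * D f + K * K * f) * e
      + (D (D g) + 2 * -K * D g + -K * -K * g) * e' :=
    fun f g => by rw [map_add, map_add, D2_mul_exp he hK, D2_mul_exp he2 hmK]
  have hs4 : ∀ f g : Smooth, D (D (D (D (f * e + g * e')))) =
      (D (D (D (D f))) + 4 * K * D (D (D f)) + 6 * K * K * D (D f)
        + 4 * K * K * K * D f + K * K * K * K * f) * e
      + (D (D (D (D g))) + 4 * -K * D (D (D g)) + 6 * -K * -K * D (D g)
        + 4 * -K * -K * -K * D g + -K * -K * -K * -K * g) * e' :=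
    fun f g => by rw [map_add, map_add, map_add, map_add, D4_mul_exp he hK, D4_mul_exp he2 hmK]
  rw [hs4, hs2, hs2, hs1, hs1]
  simp only [D_mul_of_const hDz, D_mul_of_const hDz']
  simp only [hf1, hf2, hlin, hlin2, hlin3]
  simp only [map_neg, ← hi, remDirect, remConj, hτ, hw₁, hw₂]
  -- `h1` and `h2` cancel orders two and one on the direct mode, `h3` and `h4` on the conjugate
  -- mode. They enter with powers of `K * s` where the terms to be cancelled carry the factor one;
  -- the discrepancy is divisible by `1 - K * s` and is what `w₁` and `w₂` record.
  linear_combination (K * K * K * s * z * e) * h1 + (K * K * K * s * s * z * e) * h2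
    + (K * K * K * K * s * s * z' * e') * h3 + (K * K * K * K * s * s * s * z' * e') * h4

end SymbolCalculus

/-! ### Bounded symbols built from `∂ₓ` and its truncated inverse -/

section BoundedSymbols

theorem BddSymbol.mul {m n : ℤ → ℂ} (hm : BddSymbol m) (hn : BddSymbol n) :
    BddSymbol fun k => m k * n k := by
  obtain ⟨C, hC⟩ := hm
  obtain ⟨C', hC'⟩ := hn
  exact ⟨C * C', fun k => (norm_mul_le _ _).trans (mul_le_mul (hC k) (hC' k) (norm_nonneg _)
    ((norm_nonneg _).trans (hC k)))⟩

theorem BddSymbol.add {m n : ℤ → ℂ} (hm : BddSymbol m) (hn : BddSymbol n) :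
    BddSymbol fun k => m k + n k := by
  obtain ⟨C, hC⟩ := hm
  obtain ⟨C', hC'⟩ := hn
  exact ⟨C + C', fun k => (norm_add_le _ _).trans (add_le_add (hC k) (hC' k))⟩

theorem bddSymbol_one : BddSymbol fun _ => 1 := ⟨1, fun _ => by simp⟩

/-- The symbol of `∂ₓ`. -/
noncomputable def kap (k : ℤ) : ℂ := Complex.I * k

/-- The symbol of the high-frequency part of the inverse of `∂ₓ`. -/
noncomputable def sig (N : ℕ) (k : ℤ) : ℂ := if k.natAbs < N then 0 else (kap k)⁻¹

theorem norm_kap (k : ℤ) : ‖kap k‖ = k.natAbs := by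
  rw [kap, norm_mul, Complex.norm_I, one_mul, Complex.norm_intCast, Nat.cast_natAbs, Int.cast_abs]

theorem conj_kap (k : ℤ) : conj (kap k) = -kap k := by simp [kap]

theorem conj_sig (N : ℕ) (k : ℤ) : conj (sig N k) = -sig N k := by
  unfold sig
  split_ifs
  · simp
  · rw [map_inv₀, conj_kap, inv_neg]

theorem norm_sig_le {N : ℕ} (hN : 1 ≤ N) (k : ℤ) : ‖sig N k‖ ≤ (N : ℝ)⁻¹ := by
  unfold sig
  split_ifs with h
  · simp
  · rw [norm_inv, norm_kap]
    have : (0 : ℝ) < N := by exact_mod_cast hN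
    gcongr
    exact_mod_cast not_lt.1 h

theorem norm_sig_le_one {N : ℕ} (hN : 1 ≤ N) (k : ℤ) : ‖sig N k‖ ≤ 1 :=
  (norm_sig_le hN k).trans (inv_le_one_of_one_le₀ (by exact_mod_cast hN))

/-- Thus `1 - kap * sig` lives on the finitely many frequencies below `N`, which keeps it bounded
even after multiplication by `kap` or `kap²`. -/
theorem kap_mul_sig {N : ℕ} (hN : 1 ≤ N) (k : ℤ) :
    kap k * sig N k = if k.natAbs < N then 0 else 1 := by
  unfold sig
  split_ifs with h
  · simp
  · refine mul_inv_cancel₀ ?_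
    rw [← norm_ne_zero_iff, norm_kap]
    have : k.natAbs ≠ 0 := by omega
    exact_mod_cast this

theorem bddSymbol_sig {N : ℕ} (hN : 1 ≤ N) : BddSymbol (sig N) := ⟨1, norm_sig_le_one hN⟩

theorem bddSymbol_kap_mul_sig {N : ℕ} (hN : 1 ≤ N) : BddSymbol fun k => kap k * sig N k :=
  ⟨1, fun k => by simp only [kap_mul_sig hN]; split_ifs <;> simp⟩

theorem bddSymbol_low {N : ℕ} (hN : 1 ≤ N) : BddSymbol fun k => kap k * (1 - kap k * sig N k) :=
  ⟨N, fun k => by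
    simp only [kap_mul_sig hN]
    split_ifs with h
    · rw [sub_zero, mul_one, norm_kap]
      exact_mod_cast h.le
    · simp⟩

theorem bddSymbol_low_sq {N : ℕ} (hN : 1 ≤ N) :
    BddSymbol fun k => kap k * kap k * (1 - kap k * sig N k) :=
  ⟨N * N, fun k => by
    simp only [kap_mul_sig hN]
    split_ifs with h
    · rw [sub_zero, mul_one, norm_mul, norm_kap]
      have : (k.natAbs : ℝ) ≤ N := by exact_mod_cast h.le
      gcongr
    · simp only [sub_self, mul_zero, norm_zero]
      positivity⟩

end BoundedSymbols

/-! ### Operators on `L²` defined by frequency-dependent symbols -/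

section Operators

theorem mode_eq_ofCont (k : ℤ) (ζ : ℂ) : mode coeffs k ζ = ofCont (cst ζ * ex k).1 := by
  rw [mode_coeffs]
  congr 1

/-- The family `r` of functions, depending on a frequency and on time, is the symbol of a
norm-continuous curve of bounded operators. -/
def IsSymb (r : ℤ → ℝ → Smooth) : Prop :=
  ∃ A : ℝ → L2 →L[ℝ] L2, Continuous A ∧
    ∀ k ζ t, A t (mode coeffs k ζ) = ofCont (r k t * cst ζ * ex k).1

/-- Similar to `IsSymb`, for conjugate-linear operators. -/
def IsConjSymb (r : ℤ → ℝ → Smooth) : Prop :=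
  ∃ A : ℝ → L2 →L[ℝ] L2, Continuous A ∧
    ∀ k ζ t, A t (mode coeffs k ζ) = ofCont (r k t * cst (conj ζ) * ex (-k)).1

theorem ofCont_add (f g : Smooth) : ofCont (f + g).1 = ofCont f.1 + ofCont g.1 :=
  ofCont.map_add f.1 g.1

theorem IsSymb.add {r r' : ℤ → ℝ → Smooth} (h : IsSymb r) (h' : IsSymb r') :
    IsSymb fun k t => r k t + r' k t := by
  obtain ⟨A, hA, hr⟩ := h
  obtain ⟨A', hA', hr'⟩ := h'
  refine ⟨fun t => A t + A' t, hA.add hA', fun k ζ t => ?_⟩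
  rw [add_mul, add_mul, ofCont_add, ← hr, ← hr']
  rfl

theorem IsConjSymb.add {r r' : ℤ → ℝ → Smooth} (h : IsConjSymb r) (h' : IsConjSymb r') :
    IsConjSymb fun k t => r k t + r' k t := by
  obtain ⟨A, hA, hr⟩ := h
  obtain ⟨A', hA', hr'⟩ := h'
  refine ⟨fun t => A t + A' t, hA.add hA', fun k ζ t => ?_⟩
  rw [add_mul, add_mul, ofCont_add, ← hr, ← hr']
  rfl

theorem mulOp_mult_mode (g : Smooth) {m : ℤ → ℂ} (hm : BddSymbol m) (k : ℤ) (ζ : ℂ) :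
    mulOp g.1 (mult coeffs m (mode coeffs k ζ)) = ofCont (g * cst (m k) * cst ζ * ex k).1 := by
  rw [mult_mode coeffs hm, mode_eq_ofCont, mulOp_ofCont, map_mul cst]
  congr 1
  change (g * (cst (m k) * cst ζ * ex k)).1 = _
  congr 1
  ring

theorem mulOp_conjOp_mult_mode (g : Smooth) {m : ℤ → ℂ} (hm : BddSymbol m) (k : ℤ) (ζ : ℂ) :
    mulOp g.1 (conjOp (mult coeffs m (mode coeffs k ζ)))
      = ofCont (g * cst (conj (m k)) * cst (conj ζ) * ex (-k)).1 := by
  rw [mult_mode coeffs hm, mode_eq_ofCont, conjOp_ofCont, mulOp_ofCont]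
  congr 1
  change (g * cj (cst (m k * ζ) * ex k)).1 = _
  rw [map_mul, cj_cst, cj_ex, map_mul, map_mul]
  congr 1
  ring

/-- The multiplier does not depend on time and `mulOp` is continuous in the sup norm, whence
continuity in operator norm. -/
theorem isSymb_mul {g : ℝ → Smooth} (hg : Reg g) {m : ℤ → ℂ} (hm : BddSymbol m) :
    IsSymb fun k t => g t * cst (m k) :=
  ⟨fun t => (mulOp (g t).1).comp (mult coeffs m),
    (mulOp.continuous.comp hg.continuous).clm_comp continuous_const,
    fun k ζ t => mulOp_mult_mode (g t) hm k ζ⟩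

theorem isConjSymb_mul {g : ℝ → Smooth} (hg : Reg g) {m : ℤ → ℂ} (hm : BddSymbol m) :
    IsConjSymb fun k t => g t * cst (m k) := by
  -- Conjugation acts after the multiplier, so the multiplier must carry the conjugate symbol.
  have hm' : BddSymbol fun k => conj (m k) := by
    obtain ⟨C, hC⟩ := hm
    exact ⟨C, fun k => by rw [RCLike.norm_conj]; exact hC k⟩
  refine ⟨fun t => (mulOp (g t).1).comp (conjOp.comp (mult coeffs fun k => conj (m k))),
    (mulOp.continuous.comp hg.continuous).clm_comp continuous_const, fun k ζ t => ?_⟩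
  have h := mulOp_conjOp_mult_mode (g t) hm' k ζ
  rw [Complex.conj_conj] at h
  exact h

theorem mean_D (f : Smooth) : mean (D f).1 = 0 := by
  rw [mean_apply, intervalIntegral.integral_eq_sub_of_hasDerivAt (fun y _ => hasDerivAt_lift f y)
    ((continuous_lift (D f).1).intervalIntegrable _ _)]
  have h : ((2 * Real.pi : ℝ) : Torus) = ((0 : ℝ) : Torus) := by
    rw [AddCircle.coe_period]
    rfl
  rw [h, sub_self, mul_zero]

theorem mean_cst_mul (z : ℂ) (f : Smooth) : mean (cst z * f).1 = z * mean f.1 := by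
  have : (cst z * f).1 = z • f.1 := rfl
  rw [this, map_smul, smul_eq_mul]

theorem mean_add (f g : Smooth) : mean (f + g).1 = mean f.1 + mean g.1 := mean.map_add f.1 g.1

theorem isUnit_four_I : (4 * cst Complex.I : Smooth) * cst (-Complex.I / 4) = 1 := by
  have h4 : (4 : Smooth) = cst 4 := (map_ofNat cst 4).symm
  rw [h4, ← map_mul, ← map_mul, ← map_one cst]
  congr 1
  linear_combination (-1 : ℂ) * Complex.I_mul_I

theorem isUnit_two_I : (2 * cst Complex.I : Smooth) * cst (-Complex.I / 2) = 1 := by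
  have h4 : (2 : Smooth) = cst 2 := (map_ofNat cst 2).symm
  rw [h4, ← map_mul, ← map_mul, ← map_one cst]
  congr 1
  linear_combination (-1 : ℂ) * Complex.I_mul_I

theorem D_cst_mul (z : ℂ) (f : Smooth) : D (cst z * f) = cst z * D f := by
  rw [D_mul, D_cst]
  ring

end Operators

/-! ### Transport equations and the operator `S` -/

section ConstructConjugator

/-- Families of constants that are bounded in the frequency. -/
def BddCst (f : ℤ → Smooth) : Prop := ∃ m : ℤ → ℂ, BddSymbol m ∧ ∀ k, f k = cst (m k)

theorem BddCst.mul {f g : ℤ → Smooth} (hf : BddCst f) (hg : BddCst g) :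
    BddCst fun k => f k * g k := by
  obtain ⟨m, hm, hf⟩ := hf
  obtain ⟨n, hn, hg⟩ := hg
  exact ⟨_, hm.mul hn, fun k => by simp only [hf, hg, map_mul]⟩

theorem BddCst.add {f g : ℤ → Smooth} (hf : BddCst f) (hg : BddCst g) :
    BddCst fun k => f k + g k := by
  obtain ⟨m, hm, hf⟩ := hf
  obtain ⟨n, hn, hg⟩ := hg
  exact ⟨_, hm.add hn, fun k => by simp only [hf, hg, map_add]⟩

theorem bddCst_one : BddCst fun _ => 1 := ⟨_, bddSymbol_one, fun _ => (map_one cst).symm⟩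

theorem isSymb_mul' {g : ℝ → Smooth} {f : ℤ → Smooth} (hg : Reg g) (hf : BddCst f) :
    IsSymb fun k t => g t * f k := by
  obtain ⟨m, hm, hf⟩ := hf
  simp only [hf]
  exact isSymb_mul hg hm

theorem isConjSymb_mul' {g : ℝ → Smooth} {f : ℤ → Smooth} (hg : Reg g) (hf : BddCst f) :
    IsConjSymb fun k t => g t * f k := by
  obtain ⟨m, hm, hf⟩ := hf
  simp only [hf]
  exact isConjSymb_mul hg hm

variable {p₂ q₂ p₁ q₁ p₀ q₀ a₁ a₂ c₂ c₃ n₂ n₁ : ℝ → Smooth} {i : Smooth} {s τ w₁ w₂ : ℤ → Smooth}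

theorem isSymb_remDirect (hp₂ : Reg p₂) (hq₂ : Reg q₂) (hp₁ : Reg p₁) (hq₁ : Reg q₁)
    (hp₀ : Reg p₀) (hq₀ : Reg q₀) (ha₁ : Reg a₁) (ha₂ : Reg a₂) (hc₂ : Reg c₂) (hc₃ : Reg c₃)
    (hn₂ : Reg n₂) (hn₁ : Reg n₁)
    (hs : BddCst s) (hτ : BddCst τ) (hw₁ : BddCst w₁) (hw₂ : BddCst w₂) :
    IsSymb fun k t => remDirect (p₂ t) (q₂ t) (p₁ t) (q₁ t) (p₀ t) (q₀ t) (a₁ t) (a₂ t) (c₂ t) (c₃ t)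
      (n₂ t) (n₁ t) i (s k) (τ k) (w₁ k) (w₂ k) := by
  unfold remDirect
  -- `remDirect` has twelve summands, each a regular coefficient times a bounded frequency constant;
  -- the factor in `p₀ * 1` gives the first one that shape.
  iterate 11 refine IsSymb.add ?_ (isSymb_mul' ?_ ?_)
  refine isSymb_mul' ?_ ?_
  all_goals
    with_reducible repeat' first
      | assumption | exact reg_const _ | exact bddCst_one
      | apply BddCst.add | apply BddCst.mul
      | apply Reg.add | apply Reg.sub | apply Reg.neg | apply Reg.mul | apply Reg.D | apply Reg.cj

theorem isConjSymb_remConj (hp₂ : Reg p₂) (hq₂ : Reg q₂) (hp₁ : Reg p₁) (hq₁ : Reg q₁)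
    (hp₀ : Reg p₀) (hq₀ : Reg q₀) (ha₁ : Reg a₁) (ha₂ : Reg a₂) (hc₂ : Reg c₂) (hc₃ : Reg c₃)
    (hn₂ : Reg n₂) (hn₁ : Reg n₁)
    (hs : BddCst s) (hτ : BddCst τ) (hw₁ : BddCst w₁) (hw₂ : BddCst w₂) :
    IsConjSymb fun k t => remConj (p₂ t) (q₂ t) (p₁ t) (q₁ t) (p₀ t) (q₀ t) (a₁ t) (a₂ t) (c₂ t)
      (c₃ t) (n₂ t) (n₁ t) i (s k) (τ k) (w₁ k) (w₂ k) := by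
  unfold remConj
  -- Here there are fourteen summands.
  iterate 13 refine IsConjSymb.add ?_ (isConjSymb_mul' ?_ ?_)
  refine isConjSymb_mul' ?_ ?_
  all_goals
    with_reducible repeat' first
      | assumption | exact reg_const _ | exact bddCst_one
      | apply BddCst.add | apply BddCst.mul
      | apply Reg.add | apply Reg.sub | apply Reg.neg | apply Reg.mul | apply Reg.D | apply Reg.cj

/-- Solvability of the transport equations for the symbol of the conjugating operator. -/
theorem exists_symbols (hp₂ : Reg p₂) (hq₂ : Reg q₂) (hp₁ : Reg p₁) (hq₁ : Reg q₁) :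
    ∃ a₁ a₂ c₂ c₃ : ℝ → Smooth, Reg a₁ ∧ Reg a₂ ∧ Reg c₂ ∧ Reg c₃ ∧ ∀ t,
      -(4 * cst Complex.I * D (a₁ t)) + p₂ t - cst (mean (p₂ t).1) = 0 ∧
      -(4 * cst Complex.I * D (a₂ t)) - 6 * cst Complex.I * D (D (a₁ t))
        + (p₂ t - cst (mean (p₂ t).1)) * a₁ t + p₁ t - cst (mean (p₁ t).1) = 0 ∧
      -(2 * cst Complex.I * c₂ t) + q₂ t = 0 ∧
      2 * cst Complex.I * c₃ t + 4 * cst Complex.I * D (c₂ t) - q₂ t * cj (a₁ t) - q₁ t = 0 := by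
  -- The constant is the inverse of `4i`, and `sprim` integrates `p₂` minus its mean.
  set a₁ : ℝ → Smooth := fun t => cst (-Complex.I / 4) * sprim (p₂ t) with ha₁
  have hra₁ : Reg a₁ := (reg_const _).mul hp₂.sprim
  have e1 : ∀ t, -(4 * cst Complex.I * D (a₁ t)) + p₂ t - cst (mean (p₂ t).1) = 0 := fun t => by
    simp only [ha₁, D_cst_mul, D_sprim]
    linear_combination (-(p₂ t - cst (mean (p₂ t).1))) * isUnit_four_I
  set r : ℝ → Smooth := fun t => cst (-6 * Complex.I) * D (D (a₁ t))
    + (p₂ t - cst (mean (p₂ t).1)) * a₁ t + p₁ t with hr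
  have hrr : Reg r := (((reg_const _).mul hra₁.D.D).add ((hp₂.sub hp₂.mean).mul hra₁)).add hp₁
  -- The first corrector leaves the obstruction at order one unchanged: by the first equation `(p₂ -
  -- mean p₂) a₁ = 4i a₁ ∂a₁ = ∂(2i a₁²)`, so everything in `r` except `p₁` is a derivative.
  have hmean : ∀ t, mean (r t).1 = mean (p₁ t).1 := fun t => by
    have e : (p₂ t - cst (mean (p₂ t).1)) * a₁ t = D (cst (2 * Complex.I) * (a₁ t * a₁ t)) := by
      rw [D_cst_mul, D_mul, map_mul, map_ofNat]
      linear_combination (a₁ t) * e1 t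
    simp only [hr]
    rw [mean_add, mean_add, mean_cst_mul, mean_D, e, mean_D]
    ring
  -- The unknowns `c₂` and then `c₃` appear undifferentiated in their equations, so dividing by `2i`
  -- suffices and no mean condition arises.
  set c₂ : ℝ → Smooth := fun t => cst (-Complex.I / 2) * q₂ t with hc₂
  have hrc₂ : Reg c₂ := (reg_const _).mul hq₂
  refine ⟨a₁, fun t => cst (-Complex.I / 4) * sprim (r t), c₂,
    fun t => cst (-Complex.I / 2) * (q₂ t * cj (a₁ t) + q₁ t - 4 * cst Complex.I * D (c₂ t)),
    hra₁, (reg_const _).mul hrr.sprim, hrc₂,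
    (reg_const _).mul (((hq₂.mul hra₁.cj).add hq₁).sub ((reg_const _).mul hrc₂.D)),
    fun t => ⟨e1 t, ?_, ?_, ?_⟩⟩
  · rw [D_cst_mul, D_sprim, hmean]
    simp only [hr]
    have h6 : cst (-6 * Complex.I) = -6 * cst Complex.I := by rw [map_mul, map_neg, map_ofNat]
    rw [h6]
    linear_combination (-(-6 * cst Complex.I * D (D (a₁ t))
      + (p₂ t - cst (mean (p₂ t).1)) * a₁ t + p₁ t - cst (mean (p₁ t).1))) * isUnit_four_I
  · simp only [hc₂]
    linear_combination (-q₂ t) * isUnit_two_I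
  · linear_combination (q₂ t * cj (a₁ t) + q₁ t - 4 * cst Complex.I * D (c₂ t)) * isUnit_two_I

theorem Reg.exists_hasDerivAt {a : ℝ → Smooth} (ha : Reg a) :
    ∃ a' : ℝ → C(Torus, ℂ), Continuous a' ∧ ∀ t, HasDerivAt (fun t => (a t).1) (a' t) t := (ha 0).2

theorem Reg.exists_bound {a : ℝ → Smooth} (ha : Reg a) : ∃ C : ℝ, ∀ t, ‖(a t).1‖ ≤ C := (ha 0).1

/-- The operator `1 + S` with symbols `a₁, a₂, c₂, c₃`, minus the identity. -/
noncomputable def conjS (N : ℕ) (a₁ a₂ c₂ c₃ : C(Torus, ℂ)) : L2 →L[ℝ] L2 :=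
  (mulOp a₁).comp (mult coeffs (sig N))
    + (mulOp a₂).comp (mult coeffs fun k => sig N k * sig N k)
    + (mulOp c₂).comp (conjOp.comp (mult coeffs fun k => sig N k * sig N k))
    + (mulOp c₃).comp (conjOp.comp (mult coeffs fun k => sig N k * sig N k * sig N k))

theorem hasDerivAt_conjS (N : ℕ) {a₁ a₂ c₂ c₃ : ℝ → C(Torus, ℂ)} {a₁' a₂' c₂' c₃' : C(Torus, ℂ)}
    {t : ℝ} (h1 : HasDerivAt a₁ a₁' t) (h2 : HasDerivAt a₂ a₂' t) (h3 : HasDerivAt c₂ c₂' t)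
    (h4 : HasDerivAt c₃ c₃' t) :
    HasDerivAt (fun t => conjS N (a₁ t) (a₂ t) (c₂ t) (c₃ t)) (conjS N a₁' a₂' c₂' c₃') t := by
  have key : ∀ {a : ℝ → C(Torus, ℂ)} {a' : C(Torus, ℂ)} (M : L2 →L[ℝ] L2), HasDerivAt a a' t →
      HasDerivAt (fun t => (mulOp (a t)).comp M) ((mulOp a').comp M) t := fun M h =>
    (((ContinuousLinearMap.compL ℝ L2 L2 L2).flip M).comp mulOp).hasFDerivAt.comp_hasDerivAt t h
  exact (((key _ h1).add (key _ h2)).add (key _ h3)).add (key _ h4)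

theorem continuous_conjS (N : ℕ) {a₁ a₂ c₂ c₃ : ℝ → C(Torus, ℂ)} (h1 : Continuous a₁)
    (h2 : Continuous a₂) (h3 : Continuous c₂) (h4 : Continuous c₃) :
    Continuous fun t => conjS N (a₁ t) (a₂ t) (c₂ t) (c₃ t) := by
  have key : ∀ {a : ℝ → C(Torus, ℂ)} (M : L2 →L[ℝ] L2), Continuous a →
      Continuous fun t => (mulOp (a t)).comp M := fun M h =>
    (((ContinuousLinearMap.compL ℝ L2 L2 L2).flip M).comp mulOp).continuous.comp h
  exact (((key _ h1).add (key _ h2)).add (key _ h3)).add (key _ h4)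

/-- Every term of `S` contains a factor `sig N`, of size at most `1/N`; a high cutoff therefore
makes `S` small whatever the coefficients. -/
theorem norm_conjS_le {N : ℕ} (hN : 1 ≤ N) {a₁ a₂ c₂ c₃ : C(Torus, ℂ)} {C : ℝ} (h1 : ‖a₁‖ ≤ C)
    (h2 : ‖a₂‖ ≤ C) (h3 : ‖c₂‖ ≤ C) (h4 : ‖c₃‖ ≤ C) :
    ‖conjS N a₁ a₂ c₂ c₃‖ ≤ 4 * (‖mulOp‖ * C * (1 + ‖conjOp‖)) * (N : ℝ)⁻¹ := by
  have hC : 0 ≤ C := (norm_nonneg _).trans h1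
  have hs := norm_sig_le hN
  have hs1 := norm_sig_le_one hN
  have hs2 : ∀ k, ‖sig N k * sig N k‖ ≤ (N : ℝ)⁻¹ := fun k => by
    rw [norm_mul]
    exact (mul_le_of_le_one_left (norm_nonneg _) (hs1 k)).trans (hs k)
  have hs3 : ∀ k, ‖sig N k * sig N k * sig N k‖ ≤ (N : ℝ)⁻¹ := fun k => by
    rw [norm_mul]
    exact (mul_le_of_le_one_right (norm_nonneg _) (hs1 k)).trans (hs2 k)
  have k1 : ∀ {a : C(Torus, ℂ)} {m : ℤ → ℂ}, ‖a‖ ≤ C → (∀ k, ‖m k‖ ≤ (N : ℝ)⁻¹) →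
      ‖(mulOp a).comp (mult coeffs m)‖ ≤ (‖mulOp‖ * C * (1 + ‖conjOp‖)) * (N : ℝ)⁻¹ := by
    intro a m ha hm
    calc _ ≤ ‖mulOp a‖ * ‖mult coeffs m‖ := ContinuousLinearMap.opNorm_comp_le _ _
      _ ≤ (‖mulOp‖ * C) * (N : ℝ)⁻¹ := by
        gcongr
        · exact (mulOp.le_opNorm a).trans (by gcongr)
        · exact norm_mult_le coeffs hm
      _ ≤ (‖mulOp‖ * C * (1 + ‖conjOp‖)) * (N : ℝ)⁻¹ := by
        refine mul_le_mul_of_nonneg_right ?_ (by positivity)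
        exact le_mul_of_one_le_right (by positivity) (by linarith [norm_nonneg conjOp])
  have k2 : ∀ {a : C(Torus, ℂ)} {m : ℤ → ℂ}, ‖a‖ ≤ C → (∀ k, ‖m k‖ ≤ (N : ℝ)⁻¹) →
      ‖(mulOp a).comp (conjOp.comp (mult coeffs m))‖ ≤ (‖mulOp‖ * C * (1 + ‖conjOp‖)) * (N : ℝ)⁻¹ := by
    intro a m ha hm
    calc _ ≤ ‖mulOp a‖ * ‖conjOp.comp (mult coeffs m)‖ := ContinuousLinearMap.opNorm_comp_le _ _
      _ ≤ (‖mulOp‖ * C) * ((1 + ‖conjOp‖) * (N : ℝ)⁻¹) := by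
        gcongr
        · exact (mulOp.le_opNorm a).trans (by gcongr)
        · refine (ContinuousLinearMap.opNorm_comp_le _ _).trans ?_
          exact mul_le_mul (by linarith) (norm_mult_le coeffs hm) (norm_nonneg _) (by positivity)
      _ = _ := by ring
  refine (norm_add_le _ _).trans ?_
  have := norm_add₃_le (a := (mulOp a₁).comp (mult coeffs (sig N)))
    (b := (mulOp a₂).comp (mult coeffs fun k => sig N k * sig N k))
    (c := (mulOp c₂).comp (conjOp.comp (mult coeffs fun k => sig N k * sig N k)))
  have b1 := k1 (a := a₁) h1 hs
  have b2 := k1 (a := a₂) h2 hs2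
  have b3 := k2 (a := c₂) h3 hs2
  have b4 := k2 (a := c₃) h4 hs3
  linarith

/-- `sig` is imaginary, so passing it through the conjugation changes the sign of its cube but not
of its square: hence the minus sign at `c₃`. -/
theorem add_conjS_mode {N : ℕ} (hN : 1 ≤ N) (a₁ a₂ c₂ c₃ : Smooth) (k : ℤ) (ζ : ℂ) :
    mode coeffs k ζ + conjS N a₁.1 a₂.1 c₂.1 c₃.1 (mode coeffs k ζ)
      = ofCont ((1 + a₁ * cst (sig N k) + a₂ * (cst (sig N k) * cst (sig N k))) * cst ζ * ex k
        + (c₂ * (cst (sig N k) * cst (sig N k)) - c₃ * (cst (sig N k) * cst (sig N k) * cst (sig N k)))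
          * cst (conj ζ) * ex (-k)).1 := by
  have hb := bddSymbol_sig hN
  have e : conjS N a₁.1 a₂.1 c₂.1 c₃.1 (mode coeffs k ζ)
      = mulOp a₁.1 (mult coeffs (sig N) (mode coeffs k ζ))
        + mulOp a₂.1 (mult coeffs (fun k => sig N k * sig N k) (mode coeffs k ζ))
        + mulOp c₂.1 (conjOp (mult coeffs (fun k => sig N k * sig N k) (mode coeffs k ζ)))
        + mulOp c₃.1 (conjOp (mult coeffs (fun k => sig N k * sig N k * sig N k) (mode coeffs k ζ))) :=
    rfl
  rw [e, mulOp_mult_mode _ hb, mulOp_mult_mode _ (hb.mul hb), mulOp_conjOp_mult_mode _ (hb.mul hb),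
    mulOp_conjOp_mult_mode _ ((hb.mul hb).mul hb), mode_eq_ofCont]
  simp only [← ofCont_add]
  congr 2
  simp only [map_mul, conj_sig, map_neg]
  ring

end ConstructConjugator

/-! ### Conjugation to a diagonal skew-adjoint operator -/

section ExistsConjugator

variable {p₂ q₂ p₁ q₁ p₀ q₀ : ℝ → Smooth}

/-- The differential operator with coefficients `p₂, …, q₀` can be conjugated to a diagonal
skew-adjoint operator modulo a bounded operator, provided that the mean values of `p₂` are imaginary
and those of `p₁` are real. -/
theorem exists_conjugator (hp₂ : Reg p₂) (hq₂ : Reg q₂) (hp₁ : Reg p₁) (hq₁ : Reg q₁)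
    (hp₀ : Reg p₀) (hq₀ : Reg q₀) (hm₂ : ∀ t, (mean (p₂ t).1).re = 0)
    (hm₁ : ∀ t, (mean (p₁ t).1).im = 0) :
    ∃ K : Conjugator L2, ∀ k ζ t, ∃ u : Smooth, K.T t (mode coeffs k ζ) = ofCont u.1 ∧
      K.T t (mode coeffs k (K.lam k t * Complex.I * ζ)) + K.R t (mode coeffs k ζ)
        = ofCont (diffOp (p₂ t) (q₂ t) (p₁ t) (q₁ t) (p₀ t) (q₀ t) u).1 := by
  obtain ⟨a₁, a₂, c₂, c₃, ha₁, ha₂, hc₂, hc₃, heq⟩ := exists_symbols hp₂ hq₂ hp₁ hq₁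
  obtain ⟨C₁, hC₁⟩ := ha₁.exists_bound
  obtain ⟨C₂, hC₂⟩ := ha₂.exists_bound
  obtain ⟨C₃, hC₃⟩ := hc₂.exists_bound
  obtain ⟨C₄, hC₄⟩ := hc₃.exists_bound
  obtain ⟨a₁', ha₁', hda₁⟩ := ha₁.exists_hasDerivAt
  obtain ⟨a₂', ha₂', hda₂⟩ := ha₂.exists_hasDerivAt
  obtain ⟨c₂', hc₂', hdc₂⟩ := hc₂.exists_hasDerivAt
  obtain ⟨c₃', hc₃', hdc₃⟩ := hc₃.exists_hasDerivAt
  set C := max (max C₁ C₂) (max C₃ C₄) with hC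
  -- One cutoff serves all times because `C` bounds the four symbols uniformly in `t`.
  obtain ⟨N, hN, hNB⟩ : ∃ N : ℕ, 1 ≤ N ∧
      4 * (‖mulOp‖ * C * (1 + ‖conjOp‖)) * (N : ℝ)⁻¹ ≤ 1 / 2 := by
    obtain ⟨N, hN⟩ := exists_nat_ge (8 * (‖mulOp‖ * C * (1 + ‖conjOp‖)))
    refine ⟨N + 1, by omega, ?_⟩
    have hpos : (0 : ℝ) < ((N + 1 : ℕ) : ℝ) := by positivity
    rw [← div_eq_mul_inv, div_le_iff₀ hpos]
    push_cast
    linarith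
  have hs : BddCst fun k => cst (sig N k) := ⟨_, bddSymbol_sig hN, fun _ => rfl⟩
  have hτ : BddCst fun k => cst (kap k * sig N k) := ⟨_, bddSymbol_kap_mul_sig hN, fun _ => rfl⟩
  have hw₁ : BddCst fun k => cst (kap k * (1 - kap k * sig N k)) :=
    ⟨_, bddSymbol_low hN, fun _ => rfl⟩
  have hw₂ : BddCst fun k => cst (kap k * kap k * (1 - kap k * sig N k)) :=
    ⟨_, bddSymbol_low_sq hN, fun _ => rfl⟩
  obtain ⟨A, hA, hAr⟩ := isSymb_remDirect (i := cst Complex.I) hp₂ hq₂ hp₁ hq₁ hp₀ hq₀ ha₁ ha₂ hc₂ hc₃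
    hp₂.mean hp₁.mean hs hτ hw₁ hw₂
  obtain ⟨B, hB, hBr⟩ := isConjSymb_remConj (i := cst Complex.I) hp₂ hq₂ hp₁ hq₁ hp₀ hq₀ ha₁ ha₂ hc₂
    hc₃ hp₂.mean hp₁.mean hs hτ hw₁ hw₂
  let μ : ℤ → ℝ → ℂ := fun k t => -(Complex.I * (kap k * kap k * kap k * kap k))
    + mean (p₂ t).1 * (kap k * kap k) + mean (p₁ t).1 * kap k
  -- Since `kap k = ik`, the symbol is `-ik⁴ - n₂k² + i n₁k` with `n₂`, `n₁` the means; `Re n₂ = 0`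
  -- and `Im n₁ = 0` make it imaginary.
  have hμ : ∀ k t, ((μ k t).im : ℂ) * Complex.I = μ k t := by
    intro k t
    have hre : (μ k t).re = 0 := by
      simp [μ, kap, hm₂ t, hm₁ t]
    apply Complex.ext <;> simp [hre]
  have hμc : ∀ k t, conj (μ k t) = -μ k t := by
    intro k t
    rw [← hμ k t, map_mul, Complex.conj_ofReal, Complex.conj_I]
    ring
  let K : Conjugator L2 :=
    { S := fun t => conjS N (a₁ t).1 (a₂ t).1 (c₂ t).1 (c₃ t).1
      S' := fun t => conjS N (a₁' t) (a₂' t) (c₂' t) (c₃' t)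
      R := fun t => A t + B t
      lam := fun k t => (μ k t).im
      hasDerivAt_S := fun t => hasDerivAt_conjS N (hda₁ t) (hda₂ t) (hdc₂ t) (hdc₃ t)
      continuous_S' := continuous_conjS N ha₁' ha₂' hc₂' hc₃'
      continuous_R := hA.add hB
      continuous_lam := fun k => by
        have h2 : Continuous fun t => mean (p₂ t).1 := mean.continuous.comp hp₂.continuous
        have h1 : Continuous fun t => mean (p₁ t).1 := mean.continuous.comp hp₁.continuous
        exact Complex.continuous_im.comp
          ((continuous_const.add (h2.mul continuous_const)).add (h1.mul continuous_const))
      norm_S_le := fun t => (norm_conjS_le hN ((hC₁ t).trans (by simp [hC])) ((hC₂ t).trans (by simp [hC]))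
        ((hC₃ t).trans (by simp [hC])) ((hC₄ t).trans (by simp [hC]))).trans hNB }
  have hT : ∀ k ζ t, K.T t (mode coeffs k ζ) = ofCont ((1 + a₁ t * cst (sig N k)
      + a₂ t * (cst (sig N k) * cst (sig N k))) * cst ζ * ex k
        + (c₂ t * (cst (sig N k) * cst (sig N k))
            - c₃ t * (cst (sig N k) * cst (sig N k) * cst (sig N k)))
          * cst (conj ζ) * ex (-k)).1 := fun k ζ t => add_conjS_mode hN _ _ _ _ k ζ
  refine ⟨K, fun k ζ t => ⟨_, hT k ζ t, ?_⟩⟩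
  obtain ⟨e1, e2, e3, e4⟩ := heq t
  have hl : (K.lam k t : ℂ) * Complex.I = μ k t := hμ k t
  have hR : K.R t (mode coeffs k ζ) = A t (mode coeffs k ζ) + B t (mode coeffs k ζ) := rfl
  rw [hT, hl, hR, hAr, hBr, ← ofCont_add, ← ofCont_add]
  congr 2
  rw [diffOp_conjugation (i := cst Complex.I) (K := cst (kap k)) (s := cst (sig N k))
    (z := cst ζ) (z' := cst (conj ζ)) (e := ex k) (e' := ex (-k))
    (τ := cst (kap k * sig N k)) (w₁ := cst (kap k * (1 - kap k * sig N k)))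
    (w₂ := cst (kap k * kap k * (1 - kap k * sig N k)))
    (n₂ := cst (mean (p₂ t).1)) (n₁ := cst (mean (p₁ t).1)) rfl (D_ex k) (cj_ex k) (cj_cst ζ)
    (D_cst ζ) (D_cst _) (by rw [cj_cst, conj_kap, map_neg]) (D_cst _)
    (by rw [cj_cst, conj_sig, map_neg]) (map_mul _ _ _) (by simp only [map_mul, map_sub, map_one])
    (by simp only [map_mul, map_sub, map_one]) e1 e2 e3 e4]
  -- The conjugate mode sees `conj μ = -μ`, which accounts for the minus sign in
  -- `diffOp_conjugation`.
  have hz : cst (conj (μ k t * ζ)) = -(cst (μ k t) * cst (conj ζ)) := by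
    rw [map_mul, hμc, neg_mul, map_neg, map_mul]
  have hz2 : cst (μ k t) = -(cst Complex.I * (cst (kap k) * cst (kap k) * cst (kap k) * cst (kap k)))
      + cst (mean (p₂ t).1) * (cst (kap k) * cst (kap k)) + cst (mean (p₁ t).1) * cst (kap k) := by
    simp only [μ, map_add, map_neg, map_mul]
  rw [hz, map_mul cst, ← hz2]
  ring

end ExistsConjugator

/-! ### Real matrices as complex coefficients -/

section Coefficients

theorem IsSmooth.contDiff_shift {F : Type*} [NormedAddCommGroup F] [NormedSpace ℝ F]
    {f : Torus → F} (hf : IsSmooth f) (x : Torus) :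
    ContDiff ℝ ∞ fun y : ℝ => f (x + (y : Torus)) := by
  have hf' : ContDiff ℝ ∞ fun y : ℝ => f (y : Torus) := hf
  exact QuotientAddGroup.induction_on x fun c => hf'.comp (contDiff_const.add contDiff_id)

theorem dx_clm_comp {F G : Type*} [NormedAddCommGroup F] [NormedSpace ℝ F] [NormedAddCommGroup G]
    [NormedSpace ℝ G] (L : F →L[ℝ] G) {f : Torus → F} (hf : IsSmooth f) (n : ℕ) (x : Torus) :
    dx n (fun x => L (f x)) x = L (dx n f x) := by
  have h := L.iteratedFDeriv_comp_left (hf.contDiff_shift x).contDiffAt (x := 0) (i := n)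
    (by exact_mod_cast le_top)
  have h' := congrArg (fun m => m fun _ => (1 : ℝ)) h
  exact h'

/-- The complex-valued smooth function given by a real-valued one. -/
noncomputable def realSmooth {a : Torus → ℝ} (ha : IsSmooth a) : Smooth :=
  smoothOfLift (fun x => (a x : ℂ)) (Complex.ofRealCLM.contDiff.comp ha)

theorem iterate_D_realSmooth {a : Torus → ℝ} (ha : IsSmooth a) (n : ℕ) (x : Torus) :
    (D^[n] (realSmooth ha)) x = ((dx n a x : ℝ) : ℂ) := by
  rw [← dx_eq_iterate]
  exact dx_clm_comp Complex.ofRealCLM ha n x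

theorem tendsto_of_real_tendstoUniformly {ι : Type*} {l : Filter ι} {F : ι → C(Torus, ℂ)}
    {f : C(Torus, ℂ)} {G : ι → Torus → ℝ} {g : Torus → ℝ} (h : TendstoUniformly G g l)
    (hF : ∀ i x, F i x = G i x) (hf : ∀ x, f x = g x) : Tendsto F l (𝓝 f) := by
  rw [ContinuousMap.tendsto_iff_tendstoUniformly]
  have h' := Complex.ofRealCLM.uniformContinuous.comp_tendstoUniformly h
  have e₁ : (fun i x => F i x) = fun i => (Complex.ofRealCLM : ℝ → ℂ) ∘ G i := by
    funext i x
    exact hF i x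
  have e₂ : (f : Torus → ℂ) = (Complex.ofRealCLM : ℝ → ℂ) ∘ g := funext hf
  rw [e₂]
  exact e₁ ▸ h'

/-- Convergence in each Fréchet seminorm is, order by order, convergence of `D^[n]` in the Banach
space of continuous functions. -/
theorem MemCb1.reg {a : ℝ → Torus → ℝ} (ha : MemCb1 a) :
    Reg fun t => realSmooth (ha.1.smooth t) := by
  obtain ⟨ha, a', ha', hder⟩ := ha
  intro n
  obtain ⟨C, hC⟩ := ha.bounded n
  refine ⟨⟨C, fun t => (ContinuousMap.norm_le_of_nonempty _).2 fun x => ?_⟩,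
    fun t => (D^[n] (realSmooth (ha'.smooth t))).1, ?_, fun t => ?_⟩
  · rw [iterate_D_realSmooth, Complex.norm_real]
    exact hC t x
  · exact continuous_iff_continuousAt.2 fun t => tendsto_of_real_tendstoUniformly
      (ha'.continuous n t) (fun s x => iterate_D_realSmooth _ n x)
      (fun x => iterate_D_realSmooth _ n x)
  · rw [hasDerivAt_iff_tendsto_slope]
    refine tendsto_of_real_tendstoUniformly (hder n t) (fun s x => ?_)
      (fun x => iterate_D_realSmooth _ n x)
    rw [slope_def_module]
    change ((s - t)⁻¹ : ℝ) • ((D^[n] (realSmooth (ha.smooth s))) x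
      - (D^[n] (realSmooth (ha.smooth t))) x) = _
    rw [iterate_D_realSmooth, iterate_D_realSmooth, Complex.real_smul]
    push_cast
    ring

/-- A real-linear map of `ℂ` splits into its complex-linear part `(M - JMJ)/2` and its
conjugate-linear part `(M + JMJ)/2`. -/
theorem mulVec_toVec (M : Mat) (z : ℂ) : mulVec M (toVec z) = toVec
    ((1 / 2 * (M 0 0 + M 1 1 + Complex.I * (M 1 0 - M 0 1))) * z
      + (1 / 2 * (M 0 0 - M 1 1 + Complex.I * (M 1 0 + M 0 1))) * conj z) := by
  have e : mulVec M (toVec z)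
      = !₂[M 0 0 * z.re + M 0 1 * z.im, M 1 0 * z.re + M 1 1 * z.im] := by
    rw [toVec_apply]
    ext i
    fin_cases i <;> simp [mulVec]
  rw [e, toVec_apply]
  ext i
  fin_cases i
  · simp
    ring
  · simp
    ring

/-- Transposition conjugates the complex-linear coefficient and fixes the conjugate-linear one. The
traces of `M` and `J M` see only the former, which is how the two integral conditions become
conditions on means. -/
theorem exists_matrix_symbols {M : ℝ → Torus → Mat} (hM : ∀ j k, MemCb1 fun t x => M t x j k) :
    ∃ p q : ℝ → Smooth, Reg p ∧ Reg q ∧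
      (∀ t x z, mulVec (M t x).transpose (toVec z) = toVec (conj (p t x) * z + q t x * conj z)) ∧
      (∀ t x, (p t x).re = 1 / 2 * (M t x).trace) ∧
      ∀ t x, (p t x).im = -(1 / 2 * (J * M t x).trace) := by
  refine ⟨fun t => cst (1 / 2) * (realSmooth ((hM 0 0).1.smooth t)
      + realSmooth ((hM 1 1).1.smooth t) + cst Complex.I * (realSmooth ((hM 1 0).1.smooth t)
      - realSmooth ((hM 0 1).1.smooth t))),
    fun t => cst (1 / 2) * (realSmooth ((hM 0 0).1.smooth t)
      - realSmooth ((hM 1 1).1.smooth t) + cst Complex.I * (realSmooth ((hM 1 0).1.smooth t)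
      + realSmooth ((hM 0 1).1.smooth t))), ?_, ?_, fun t x z => ?_, fun t x => ?_, fun t x => ?_⟩
  · exact (reg_const _).mul (((hM 0 0).reg.add (hM 1 1).reg).add
      ((reg_const _).mul ((hM 1 0).reg.sub (hM 0 1).reg)))
  · exact (reg_const _).mul (((hM 0 0).reg.sub (hM 1 1).reg).add
      ((reg_const _).mul ((hM 1 0).reg.add (hM 0 1).reg)))
  · rw [mulVec_toVec]
    change _ = toVec (conj ((1 / 2 : ℂ) * ((M t x 0 0 : ℂ) + (M t x 1 1 : ℂ)
      + Complex.I * ((M t x 1 0 : ℂ) - (M t x 0 1 : ℂ)))) * z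
      + ((1 / 2 : ℂ) * ((M t x 0 0 : ℂ) - (M t x 1 1 : ℂ)
      + Complex.I * ((M t x 1 0 : ℂ) + (M t x 0 1 : ℂ)))) * conj z)
    congr 1
    simp only [map_mul, map_add, map_sub, Complex.conj_ofReal, Complex.conj_I, map_div₀, map_one,
      map_ofNat, Matrix.transpose_apply]
    ring
  · change ((1 / 2 : ℂ) * ((M t x 0 0 : ℂ) + (M t x 1 1 : ℂ)
      + Complex.I * ((M t x 1 0 : ℂ) - (M t x 0 1 : ℂ)))).re = _
    simp [Matrix.trace_fin_two]
  · change ((1 / 2 : ℂ) * ((M t x 0 0 : ℂ) + (M t x 1 1 : ℂ)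
      + Complex.I * ((M t x 1 0 : ℂ) - (M t x 0 1 : ℂ)))).im = _
    have hJ : (J * M t x).trace = M t x 0 1 - M t x 1 0 := by
      rw [Matrix.trace_fin_two, Matrix.mul_apply, Matrix.mul_apply, Fin.sum_univ_two,
        Fin.sum_univ_two]
      simp [J]
      ring
    rw [hJ]
    simp
    ring

theorem mean_re (f : C(Torus, ℂ)) :
    (mean f).re = (2 * Real.pi)⁻¹ * ∫ y in (0 : ℝ)..2 * Real.pi, (f (y : Torus)).re := by
  have h := Complex.reCLM.intervalIntegral_comp_comm
    ((continuous_lift f).intervalIntegrable (μ := volume) 0 (2 * Real.pi))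
  simp only [Complex.reCLM_apply] at h
  rw [mean_apply, h, ← Complex.re_ofReal_mul]
  push_cast
  rfl

theorem mean_im (f : C(Torus, ℂ)) :
    (mean f).im = (2 * Real.pi)⁻¹ * ∫ y in (0 : ℝ)..2 * Real.pi, (f (y : Torus)).im := by
  have h := Complex.imCLM.intervalIntegral_comp_comm
    ((continuous_lift f).intervalIntegrable (μ := volume) 0 (2 * Real.pi))
  simp only [Complex.imCLM_apply] at h
  rw [mean_apply, h, ← Complex.im_ofReal_mul]
  push_cast
  rfl

end Coefficients

/-! ### The formal adjoint and integration by parts -/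

section Adjoint

/-- The adjoint of `-(i ∂⁴ + (pβ + qβ C) ∂² + (pγ + qγ C) ∂)`, up to the sign. -/
noncomputable def adjOp (pβ qβ pγ qγ f : Smooth) : Smooth :=
  diffOp (cj pβ) qβ (2 * D (cj pβ) - cj pγ) (2 * D qβ - qγ) (D (D (cj pβ)) - D (cj pγ))
    (D (D qβ) - D qγ) f

/-- Carrying the derivatives past the coefficients gives the formal adjoint the shape of `diffOp`;
the terms of order zero in `diffOp` are there to absorb what the Leibniz rule produces. -/
theorem adjOp_eq (pβ qβ pγ qγ f : Smooth) : adjOp pβ qβ pγ qγ f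
    = D (D (D (D (cst (-Complex.I) * f)))) + D (D (cj pβ * f + qβ * cj f))
      - D (cj pγ * f + qγ * cj f) := by
  simp only [adjOp, diffOp, map_neg, D_mul, D_cst, map_add, map_zero]
  ring

theorem mulVec_J_transpose (z : ℂ) : mulVec J.transpose (toVec z) = toVec (-Complex.I * z) := by
  rw [mulVec_toVec]
  congr 1
  simp [J]
  ring

theorem dx_toVec (f : Smooth) (n : ℕ) (x : Torus) :
    dx n (fun x => toVec (f x)) x = toVec ((D^[n] f) x) := by
  rw [← dx_eq_iterate]
  exact dx_clm_comp (toVec.toContinuousLinearEquiv : ℂ →L[ℝ] Vec) f.2 n x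

theorem adjointOp_toVec {β γ : ℝ → Torus → Mat} {t : ℝ} {pβ qβ pγ qγ : Smooth}
    (hβ : ∀ x z, mulVec (β t x).transpose (toVec z) = toVec (conj (pβ x) * z + qβ x * conj z))
    (hγ : ∀ x z, mulVec (γ t x).transpose (toVec z) = toVec (conj (pγ x) * z + qγ x * conj z))
    (f : Smooth) (x : Torus) :
    adjointOp β γ t (fun x => toVec (f x)) x = toVec (adjOp pβ qβ pγ qγ f x) := by
  have h₄ := dx_toVec (cst (-Complex.I) * f) 4 x
  have h₂ := dx_toVec (cj pβ * f + qβ * cj f) 2 x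
  have h₁ := dx_toVec (cj pγ * f + qγ * cj f) 1 x
  simp only [adjointOp, hβ, hγ, mulVec_J_transpose]
  refine (congrArg₂ (· - ·) (congrArg₂ (· + ·) h₄ h₂) h₁).trans ?_
  rw [adjOp_eq, ← map_add, ← map_sub]
  rfl

theorem inner_ofCont_ofCont (f g : Smooth) :
    inner ℝ (ofCont f.1) (ofCont g.1) = 2 * Real.pi * (mean (cj f * g).1).re := by
  have h : ∫ x, inner ℝ (ofCont f.1 x) (toVec (g x)) = ∫ x : Torus, ((cj f * g) x).re := by
    refine integral_congr_ae ?_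
    filter_upwards [coeFn_ofCont f.1] with x hx
    rw [hx, inner_toVec]
    rfl
  have h' := AddCircle.intervalIntegral_preimage (2 * Real.pi) 0 fun x : Torus => ((cj f * g) x).re
  rw [inner_ofCont, h, mean_re, ← h', zero_add]
  have := Real.pi_pos
  field_simp

theorem mean_cj_re (f : Smooth) : (mean (cj f).1).re = (mean f.1).re := by
  rw [mean_re, mean_re]
  rfl

/-- The two integrands add up to an exact derivative, of mean zero, plus a difference `g - conj g`,
whose mean is imaginary and so invisible to the real inner product. -/
theorem inner_diffOp_eq (pβ qβ pγ qγ u f : Smooth) :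
    inner ℝ (ofCont (diffOp (-pβ) (-qβ) (-pγ) (-qγ) 0 0 u).1) (ofCont f.1)
      = -inner ℝ (ofCont u.1) (ofCont (adjOp pβ qβ pγ qγ f).1) := by
  set i := cst Complex.I with hi
  have hDi : D i = 0 := D_cst _
  have hci : cj i = -i := by rw [hi, cj_cst, Complex.conj_I, map_neg]
  have hni : cst (-Complex.I) = -i := by rw [map_neg]
  set v := cj u with hv
  have hu : cj v = u := cj_cj u
  have key : cj (diffOp (-pβ) (-qβ) (-pγ) (-qγ) 0 0 u) * f + v * adjOp pβ qβ pγ qγ f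
      = D (i * (D (D (D v)) * f - D (D v) * D f + D v * D (D f) - v * D (D (D f)))
          + (v * D (cj pβ * f + qβ * cj f) - D v * (cj pβ * f + qβ * cj f))
          - v * (cj pγ * f + qγ * cj f))
        + (qβ * D (D v) * cj f + qγ * D v * cj f - cj (qβ * D (D v) * cj f + qγ * D v * cj f)) := by
    rw [adjOp_eq, diffOp, ← hi, hni]
    simp only [map_add, map_sub, map_neg, map_mul, D_mul, hDi, hci, cj_cj, ← D_cj, ← hv, hu, map_zero,
      zero_mul, add_zero]
    ring
  have hm : (mean (cj (diffOp (-pβ) (-qβ) (-pγ) (-qγ) 0 0 u) * f).1).re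
      + (mean (v * adjOp pβ qβ pγ qγ f).1).re = 0 := by
    rw [← Complex.add_re, ← mean_add, key, mean_add, mean_D, sub_eq_add_neg, mean_add, zero_add,
      Complex.add_re, ← map_neg, mean_cj_re, ← Complex.add_re,
      ← mean_add, add_neg_cancel]
    exact congrArg Complex.re (map_zero mean)
  rw [inner_ofCont_ofCont, inner_ofCont_ofCont, ← hv]
  linear_combination 2 * Real.pi * hm

end Adjoint

/-! ### Well-posedness of the initial value problem -/

section WellPosedness

theorem reg_adjOp {pβ qβ pγ qγ : ℝ → Smooth} (h₁ : Reg pβ) (h₂ : Reg qβ) (h₃ : Reg pγ)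
    (h₄ : Reg qγ) (f : Smooth) : Reg fun t => adjOp (pβ t) (qβ t) (pγ t) (qγ t) f := by
  unfold adjOp diffOp
  with_reducible
    repeat' first | assumption | exact reg_const _ | apply Reg.add | apply Reg.sub | apply Reg.neg
                  | apply Reg.mul | apply Reg.D | apply Reg.cj

theorem exists_smooth_eq_toVec {φ : Torus → Vec} (hφ : IsSmooth φ) :
    ∃ f : Smooth, φ = fun x => toVec (f x) :=
  ⟨smoothOfLift (fun x => toVec.symm (φ x)) (toVec.symm.contDiff.comp hφ),
    funext fun x => (toVec.apply_symm_apply (φ x)).symm⟩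

theorem isSmooth_toVec (f : Smooth) : IsSmooth fun x => toVec (f x) :=
  toVec.contDiff.comp (contDiff_lift f)

theorem isSolution_iff {β γ : ℝ → Torus → Mat} {pβ qβ pγ qγ : ℝ → Smooth}
    (hβ : ∀ t x z, mulVec (β t x).transpose (toVec z)
      = toVec (conj (pβ t x) * z + qβ t x * conj z))
    (hγ : ∀ t x z, mulVec (γ t x).transpose (toVec z)
      = toVec (conj (pγ t x) * z + qγ t x * conj z))
    {h : ℝ → L2} {w₀ : L2} {w : C(ℝ, L2)} :
    IsSolution β γ h w₀ w ↔ w 0 = w₀ ∧ ∀ (f : Smooth) (t : ℝ),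
      inner ℝ (w t) (ofCont f.1) - inner ℝ (w 0) (ofCont f.1)
        = ∫ s in (0 : ℝ)..t, (inner ℝ (h s) (ofCont f.1)
          - inner ℝ (w s) (ofCont (adjOp (pβ s) (qβ s) (pγ s) (qγ s) f).1)) := by
  have key : ∀ (f : Smooth) (s : ℝ) (u : L2),
      ∫ x, inner ℝ (u x) (adjointOp β γ s (fun x => toVec (f x)) x)
        = inner ℝ u (ofCont (adjOp (pβ s) (qβ s) (pγ s) (qγ s) f).1) := by
    intro f s u
    rw [inner_ofCont]
    simp only [adjointOp_toVec (hβ s) (hγ s)]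
  constructor
  · rintro ⟨h0, hw⟩
    refine ⟨h0, fun f t => ?_⟩
    have := hw _ (isSmooth_toVec f) t
    simpa only [key, ← inner_ofCont] using this
  · rintro ⟨h0, hw⟩
    refine ⟨h0, fun φ hφ t => ?_⟩
    obtain ⟨f, rfl⟩ := exists_smooth_eq_toVec hφ
    simpa only [key, ← inner_ofCont] using hw f t

/-- Existence conjugates the operator itself; uniqueness conjugates its formal adjoint, the operator
that falls on the test functions. -/
theorem l2WellPosed_of_symbols {β γ : ℝ → Torus → Mat} {pβ qβ pγ qγ : ℝ → Smooth}
    (h₁ : Reg pβ) (h₂ : Reg qβ) (h₃ : Reg pγ) (h₄ : Reg qγ)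
    (hβ : ∀ t x z, mulVec (β t x).transpose (toVec z)
      = toVec (conj (pβ t x) * z + qβ t x * conj z))
    (hγ : ∀ t x z, mulVec (γ t x).transpose (toVec z)
      = toVec (conj (pγ t x) * z + qγ t x * conj z))
    (hmβ : ∀ t, (mean (pβ t).1).re = 0) (hmγ : ∀ t, (mean (pγ t).1).im = 0) :
    L2WellPosed β γ := by
  intro w₀ h hh
  refine existsUnique_of_exists_of_unique ?_ ?_
  · obtain ⟨K, hK⟩ := exists_conjugator h₁.neg h₂.neg h₃.neg h₄.neg (reg_const 0) (reg_const 0)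
      (fun t => by
        have : mean (-pβ t).1 = -mean (pβ t).1 := map_neg mean _
        rw [this, Complex.neg_re, hmβ, neg_zero])
      (fun t => by
        have : mean (-pγ t).1 = -mean (pγ t).1 := map_neg mean _
        rw [this, Complex.neg_im, hmγ, neg_zero])
    obtain ⟨w, hwc, hw0, hw⟩ := K.exists_weak_solution coeffs hh w₀
    refine ⟨⟨w, hwc⟩, (isSolution_iff hβ hγ).2 ⟨hw0, fun f t => ?_⟩⟩
    refine hw (ofCont f.1) (fun s => ofCont (adjOp (pβ s) (qβ s) (pγ s) (qγ s) f).1)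
      (ofCont.continuous.comp (reg_adjOp h₁ h₂ h₃ h₄ f).continuous) (fun k ζ s => ?_) t
    obtain ⟨u, hu, hu'⟩ := hK k ζ s
    rw [hu, hu', inner_diffOp_eq]
  · intro w w' hw hw'
    obtain ⟨hw0, hw⟩ := (isSolution_iff hβ hγ).1 hw
    obtain ⟨hw0', hw'⟩ := (isSolution_iff hβ hγ).1 hw'
    obtain ⟨K, hK⟩ := exists_conjugator h₁.cj h₂ (((reg_const 2).mul h₁.cj.D).sub h₃.cj)
      (((reg_const 2).mul h₂.D).sub h₄) (h₁.cj.D.D.sub h₃.cj.D) (h₂.D.D.sub h₄.D)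
      (fun t => by rw [mean_cj_re, hmβ])
      (fun t => by
        -- The term that `β` adds to the first-order coefficient of the adjoint is a derivative, so
        -- only the mean of `pγ` counts.
        have e : 2 * D (cj (pβ t)) - cj (pγ t) = D (2 * cj (pβ t)) + -cj (pγ t) := by
          have h2 : D (2 : Smooth) = 0 := by
            rw [← map_ofNat cst 2]
            exact D_cst 2
          rw [D_mul, h2]
          ring
        have e' : mean (-cj (pγ t)).1 = -mean (cj (pγ t)).1 := map_neg mean _
        rw [e, mean_add, mean_D, zero_add, e', Complex.neg_im, mean_im]
        have h := hmγ t
        rw [mean_im] at h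
        have hc : ∀ y : ℝ, ((cj (pγ t)).1 (y : Torus)).im = -((pγ t).1 (y : Torus)).im :=
          fun y => rfl
        simp only [hc, intervalIntegral.integral_neg]
        linarith)
    have hcont : ∀ (v : C(ℝ, L2)) (f : Smooth), Continuous fun s =>
        inner ℝ (v s) (ofCont (adjOp (pβ s) (qβ s) (pγ s) (qγ s) f).1) := fun v f =>
      v.continuous.inner (ofCont.continuous.comp (reg_adjOp h₁ h₂ h₃ h₄ f).continuous)
    have hint : ∀ (f : Smooth) (t : ℝ), IntervalIntegrable (fun s => inner ℝ (h s) (ofCont f.1))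
        volume 0 t := by
      intro f t
      have hi : IntervalIntegrable h volume 0 t :=
        ⟨(hh.integrableOn_isCompact isCompact_Icc).mono_set Set.Ioc_subset_Icc_self,
          (hh.integrableOn_isCompact isCompact_Icc).mono_set Set.Ioc_subset_Icc_self⟩
      have hL := ((innerSL ℝ (ofCont f.1)).integrable_comp hi.1)
      have hR := ((innerSL ℝ (ofCont f.1)).integrable_comp hi.2)
      simp only [innerSL_apply_apply, real_inner_comm] at hL hR
      exact ⟨hL, hR⟩
    have hdiff : ∀ (f : Smooth) (t : ℝ), inner ℝ (w t - w' t) (ofCont f.1)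
        = -∫ s in (0 : ℝ)..t,
          inner ℝ (w s - w' s) (ofCont (adjOp (pβ s) (qβ s) (pγ s) (qγ s) f).1) := by
      intro f t
      have h1 := hw f t
      have h2 := hw' f t
      rw [intervalIntegral.integral_sub (hint f t) ((hcont _ f).intervalIntegrable _ _)] at h1 h2
      simp only [inner_sub_left]
      rw [intervalIntegral.integral_sub ((hcont w f).intervalIntegrable _ _)
        ((hcont w' f).intervalIntegrable _ _)]
      rw [hw0] at h1
      rw [hw0'] at h2
      linear_combination h1 - h2
    -- For fixed `s`, `T s` applied to a mode is smooth, hence an admissible test function; the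
    -- integrand being continuous, the integrated identity can be differentiated at `s`.
    have hz := K.eq_zero_of_weak coeffs (w := fun t => w t - w' t)
      (w.continuous.sub w'.continuous) (by simp [hw0, hw0']) (fun k ζ s => by
        obtain ⟨u, hu, hu'⟩ := hK k ζ s
        rw [hu, hu']
        have hc := hcont (w - w') u
        have hd := (intervalIntegral.integral_hasDerivAt_right (hc.intervalIntegrable 0 s)
          hc.stronglyMeasurable.stronglyMeasurableAtFilter hc.continuousAt).neg
        exact hd.of_eq (fun t => hdiff u t) rfl)
    exact ContinuousMap.ext fun t => sub_eq_zero.1 (hz t)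

end WellPosedness

end DispersiveTorus

theorem theorem3p2 (β γ : ℝ → DispersiveTorus.Torus → DispersiveTorus.Mat)
    (hβ : ∀ j k : Fin 2, DispersiveTorus.MemCb1 (fun t x => β t x j k))
    (hγ : ∀ j k : Fin 2, DispersiveTorus.MemCb1 (fun t x => γ t x j k))
    (hβtr : ∀ t : ℝ, ∫ x in (0 : ℝ)..2 * Real.pi,
      (β t (x : DispersiveTorus.Torus)).trace = 0)
    (hγtr : ∀ t : ℝ, ∫ x in (0 : ℝ)..2 * Real.pi,
      (DispersiveTorus.J * γ t (x : DispersiveTorus.Torus)).trace = 0) :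
    DispersiveTorus.L2WellPosed β γ := by
  obtain ⟨pβ, qβ, h₁, h₂, hmulβ, hreβ, -⟩ := DispersiveTorus.exists_matrix_symbols hβ
  obtain ⟨pγ, qγ, h₃, h₄, hmulγ, -, himγ⟩ := DispersiveTorus.exists_matrix_symbols hγ
  refine DispersiveTorus.l2WellPosed_of_symbols h₁ h₂ h₃ h₄ hmulβ hmulγ (fun t => ?_) fun t => ?_
  · rw [DispersiveTorus.mean_re]
    simp only [hreβ, intervalIntegral.integral_const_mul, hβtr, mul_zero]
  · rw [DispersiveTorus.mean_im]
    simp only [himγ, intervalIntegral.integral_neg, intervalIntegral.integral_const_mul, hγtr,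
      mul_zero, neg_zero]
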